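/- A constraint of arity $k$ is a function $f:\{0,1\}^k\to\mathbb{R}^{\ge 0}$; its underlying relation is $R_f=\{x : f(x)\neq 0\}$. A binary constraint is written $(f(00),f(01),f(10),f(11))$; put $EQ=(1,0,0,1)$, $XOR=(0,1,1,0)$, $Implies=(1,1,0,1)$, and let $\mathcal{U}$ be the set of all unary constraints. Let $\mathcal{ED}$ be the set of all constraints that are finite products of unary constraints, $EQ$ and $XOR$, applied to the variables of the constraint. A constraint $f$ has affine support if $R_f$ is the solution set of a system of linear equations over $GF(2)$; it has imp support if $R_f$ is the conjunction of a positive number of relations of the forms $x_i=0$, $x_i=1$, and $Implies(x_i,x_j)$ with $i\neq j$. For a set $\mathcal{F}$ of constraints, $\mathrm{MAX\text{-}PROD\text{-}CSP}^*(\mathcal{F})$ is the following maximization problem. Instance: a number $n$ of Boolean variables and a finite list (repetitions allowed) of pairs $\langle h,(x_{i_1},\dots,x_{i_k})\rangle$ with $h\in\mathcal{F}\cup\mathcal{U}$ of arity $k$ and $i_1,\dots,i_k\in\{1,\dots,n\}$, not necessarily distinct. Solution: an assignment $\sigma\in\{0,1\}^n$. Measure: $\prod_{\langle h,(x_{i_1},\dots,x_{i_k})\rangle}h(\sigma(x_{i_1}),\dots,\sigma(x_{i_k}))$.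 Instances are words of real numbers ($n$ in unary, indices, and the table of the $2^k$ values of every listed constraint), and the size $|x|$ of an instance is the sum of the sizes of the entries of this word, where a real $r\ne0$ has size $1+|\log_2|r||$ and $0$ has size $1$. With $m^*(x)$ the maximum measure, a solution $y$ of $x$ is $\alpha$-approximate if $1/\alpha\le m(x,y)/m^*(x)\le\alpha$ when $m^*(x)\neq0$, and $m(x,y)=0$ when $m^*(x)=0$. A randomized approximation scheme for a problem outputs, on input $(x,\varepsilon)$ with $\varepsilon\in(0,1)$, a $2^{\varepsilon}$-approximate solution with probability at least $3/4$. A problem $P$ is APT-reducible to $Q$ if there are a randomized oracle algorithm $N$ (a finite program over real-number cells with unit-cost arithmetic, comparisons, coin tosses and oracle calls) and polynomials $p,q$ such that, for every randomized approximation scheme $M$ for $Q$ (of unrestricted complexity) used as oracle, each call being answered by a fresh random outcome of $M$: (i) $N$ is a randomized approximation scheme for $P$; (ii) on input $(x,\varepsilon)$ every oracle call has the form $(w,\delta)$ with $w$ an instance of $Q$, $\delta\in(0,1)$ and $1/\delta\le p(|x|,1/\varepsilon)$; (iii) on input $(x,\varepsilon)$, $N$ always halts within $q(|x|,1/\varepsilon)$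 steps. **Proposition.** Let $f$ be a constraint that has imp support. If $f$ does not have affine support or $f\notin\mathcal{ED}$, then, for every set $\mathcal{F}$ of constraints, $\mathrm{MAX\text{-}PROD\text{-}CSP}^*(\{Implies\}\cup\mathcal{F})$ is APT-reducible to $\mathrm{MAX\text{-}PROD\text{-}CSP}^*(\{f\}\cup\mathcal{F})$. -/

import Mathlib

open scoped NNReal ENNReal

noncomputable section

/-! ### Constraints -/

/-- A nonnegative-real-weighted Boolean constraint `{0,1}^k → ℝ≥0`; `false` is `0`, `true` is `1`. -/
structure Constraint where
  arity : ℕ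
  val : (Fin arity → Bool) → ℝ≥0

namespace Constraint

/-- The list of values in the lexicographic order of `{0,1}^k`
(the first coordinate is the most significant one). -/
def table : (k : ℕ) → ((Fin k → Bool) → ℝ≥0) → List ℝ≥0
  | 0, g => [g Fin.elim0]
  | k + 1, g =>
      table k (fun x => g (Fin.cons false x)) ++ table k (fun x => g (Fin.cons true x))

/-- `Implies = (1,1,0,1)`. -/
def implies : Constraint := ⟨2, fun x => if x 0 = true ∧ x 1 = false then 0 else 1⟩

/-- `EQ = (1,0,0,1)`. -/
def eq : Constraint := ⟨2, fun x => if x 0 = x 1 then 1 else 0⟩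

/-- `XOR = (0,1,1,0)`. -/
def xor : Constraint := ⟨2, fun x => if x 0 = x 1 then 0 else 1⟩

/-- The set `𝒰` of all unary constraints. -/
def unary : Set Constraint := {c | c.arity = 1}

/-- A constraint together with the variables, out of `x_0, …, x_{n-1}`, to which it is applied.
Variables may be repeated. -/
structure Applied (n : ℕ) where
  con : Constraint
  scope : Fin con.arity → Fin n

/-- The value of an applied constraint at an assignment of the variables. -/
def Applied.eval {n : ℕ} (a : Applied n) (σ : Fin n → Bool) : ℝ≥0 :=
  a.con.val (fun i => σ (a.scope i))

/-- The product of a finite collection of applied constraints at an assignment. -/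
def prodEval {n : ℕ} (H : List (Applied n)) (σ : Fin n → Bool) : ℝ≥0 :=
  (H.map (fun a => a.eval σ)).prod

/-- The set `ED` of all constraints that are products of unary constraints, `EQ` and `XOR`,
applied to the variables of the constraint. -/
def ED : Set Constraint :=
  {f | ∃ H : List (Applied f.arity),
    (∀ a ∈ H, a.con ∈ unary ∪ {eq, xor}) ∧ ∀ x, f.val x = prodEval H x}

/-- The underlying relation `R_f = {x | f x ≠ 0}`. -/
def support (f : Constraint) : Set (Fin f.arity → Bool) := {x | f.val x ≠ 0}

/-- A relation is affine if it is the solution set of a system of linear equations over `GF(2)`. -/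
def IsAffine {k : ℕ} (R : Set (Fin k → Bool)) : Prop :=
  ∃ (m : ℕ) (A : Matrix (Fin m) (Fin k) (ZMod 2)) (b : Fin m → ZMod 2),
    ∀ x, x ∈ R ↔ A.mulVec (fun i => if x i = true then 1 else 0) = b

def HasAffineSupport (f : Constraint) : Prop := IsAffine f.support

/-- The atomic relations `Δ₀(x_i)`, `Δ₁(x_i)` and `Implies(x_i, x_j)` (with `x_i`, `x_j` distinct
variables) on `k` variables. -/
inductive ImpAtom (k : ℕ) where
  | delta0 (i : Fin k)
  | delta1 (i : Fin k)
  | imp (i j : Fin k) (h : i ≠ j)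

def ImpAtom.Holds {k : ℕ} (x : Fin k → Bool) : ImpAtom k → Prop
  | .delta0 i => x i = false
  | .delta1 i => x i = true
  | .imp i j _ => x i = true → x j = true

/-- `R_f` is a conjunction of a positive number of relations `Δ₀(x)`, `Δ₁(x)`, `Implies(x,y)`. -/
def HasImpSupport (f : Constraint) : Prop :=
  ∃ L : List (ImpAtom f.arity), L ≠ [] ∧ ∀ x, x ∈ f.support ↔ ∀ a ∈ L, a.Holds x

end Constraint

/-! ### Optimization problems and approximate solutions -/

/-- A maximization problem. Instances and solutions are presented to machines as words over `ℝ`. -/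
structure MaxProblem where
  Inst : Type
  Sol : Inst → Type
  measure : (x : Inst) → Sol x → ℝ≥0
  encInst : Inst → List ℝ
  encSol : (x : Inst) → Sol x → List ℝ

/-- The size of a word over `ℝ`: the sum of the sizes of its entries, the entry `r` having the size
`1 + |log₂ |r||`, and the entry `0` the size `1`. -/
def wordSize (w : List ℝ) : ℝ := (w.map (fun r => 1 + |Real.logb 2 (|r|)|)).sum

namespace MaxProblem

/-- The size `|x|` of an instance. -/
def size (P : MaxProblem) (x : P.Inst) : ℝ := wordSize (P.encInst x)

/-- `y` is an `α`-approximate solution: `1/α ≤ m(x,y)/m*(x) ≤ α`, where `m*(x)` is the optimum;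
if `m*(x) = 0` then it is required that `m(x,y) = 0`. -/
def IsApproxSol (P : MaxProblem) (x : P.Inst) (α : ℝ) (y : P.Sol x) : Prop :=
  ∃ opt : ℝ≥0, IsGreatest (Set.range (P.measure x)) opt ∧
    (opt = 0 → P.measure x y = 0) ∧
    (opt ≠ 0 → 1 / α ≤ (P.measure x y : ℝ) / opt ∧ (P.measure x y : ℝ) / opt ≤ α)

/-- The outputs that encode `2^ε`-approximate solutions of `x`. -/
def goodOutputs (P : MaxProblem) (x : P.Inst) (ε : ℝ) : Set (List ℝ) :=
  {o | ∃ y : P.Sol x, o = P.encSol x y ∧ P.IsApproxSol x ((2 : ℝ) ^ ε) y}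

end MaxProblem

/-- The behaviour of a (not necessarily resource-bounded) randomized algorithm on words over `ℝ`:
the distribution of its output on each input. -/
abbrev Oracle := List ℝ → PMF (List ℝ)

/-- `M` is a randomized approximation scheme for `P`. The input `(x, ε)` is the word that starts
with `ε` and goes on with the encoding of `x`. -/
def IsRandomizedApproxScheme (P : MaxProblem) (M : Oracle) : Prop :=
  ∀ (x : P.Inst) (ε : ℝ), 0 < ε → ε < 1 →
    (3 / 4 : ℝ≥0∞) ≤ (M (ε :: P.encInst x)).toOuterMeasure (P.goodOutputs x ε)

/-! ### Randomized oracle machines over the reals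

A machine is a finite program that works on stacks of real numbers, with unit-cost arithmetic and
comparisons, fair coin tosses and oracle calls. Only the finitely many stacks that are named in the
program can be accessed by it. -/

/-- Arithmetic operations (with `r / 0 = 0`). -/
inductive ArithOp where
  | add
  | sub
  | mul
  | div

def ArithOp.apply : ArithOp → ℝ → ℝ → ℝ
  | .add, a, b => a + b
  | .sub, a, b => a - b
  | .mul, a, b => a * b
  | .div, a, b => a / b

/-- The contents of the stacks; the head of a list is the top of the stack. -/
abbrev Memory := ℕ → List ℝ

/-- The top of the stack `s`, read as `0` if the stack is empty. -/
def Memory.top (μ : Memory) (s : ℕ) : ℝ := (μ s).headD 0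

def Memory.push (μ : Memory) (s : ℕ) (r : ℝ) : Memory := Function.update μ s (r :: μ s)

/-- Tests: whether stack `s` is non-empty; whether the top of `s` is at most the top of `t`. -/
inductive Test where
  | nonempty (s : ℕ)
  | le (s t : ℕ)

def Test.Holds (μ : Memory) : Test → Prop
  | .nonempty s => μ s ≠ []
  | .le s t => μ.top s ≤ μ.top t

/-- Programs. -/
inductive Prog where
  /-- do nothing -/
  | skip
  /-- push the constant `r` on stack `s` -/
  | const (s : ℕ) (r : ℝ)
  /-- remove the top of stack `s` -/
  | pop (s : ℕ)
  /-- push the top of stack `s` on stack `t` -/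
  | copy (s t : ℕ)
  /-- apply `op` to the tops of stacks `s` and `t` and push the result on stack `u` -/
  | arith (op : ArithOp) (s t u : ℕ)
  /-- push a fair random bit on stack `s` -/
  | flip (s : ℕ)
  /-- call the oracle on the word on stack `q`, erase that word, and put the answer on stack `a` -/
  | call (q a : ℕ)
  | seq (c d : Prog)
  | cond (b : Test) (c d : Prog)
  | loop (b : Test) (c : Prog)

/-- A configuration: the programs still to be executed, in this order, and the memory. -/
structure Config where
  code : List Prog
  mem : Memory

namespace Config

open scoped Classical in
/-- One step of the computation with oracle `M`. Every call of the oracle and every coin toss uses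
fresh randomness. A configuration without remaining code has halted and does not change. -/
def step (M : Oracle) : Config → PMF Config
  | ⟨[], μ⟩ => PMF.pure ⟨[], μ⟩
  | ⟨.skip :: k, μ⟩ => PMF.pure ⟨k, μ⟩
  | ⟨.const s r :: k, μ⟩ => PMF.pure ⟨k, μ.push s r⟩
  | ⟨.pop s :: k, μ⟩ => PMF.pure ⟨k, Function.update μ s (μ s).tail⟩
  | ⟨.copy s t :: k, μ⟩ => PMF.pure ⟨k, μ.push t (μ.top s)⟩
  | ⟨.arith op s t u :: k, μ⟩ => PMF.pure ⟨k, μ.push u (op.apply (μ.top s) (μ.top t))⟩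
  | ⟨.flip s :: k, μ⟩ =>
      (PMF.uniformOfFintype Bool).map (fun b => ⟨k, μ.push s (if b then 1 else 0)⟩)
  | ⟨.call q a :: k, μ⟩ =>
      (M (μ q)).map (fun w => ⟨k, Function.update (Function.update μ q []) a w⟩)
  | ⟨.seq c d :: k, μ⟩ => PMF.pure ⟨c :: d :: k, μ⟩
  | ⟨.cond b c d :: k, μ⟩ => PMF.pure (if b.Holds μ then ⟨c :: k, μ⟩ else ⟨d :: k, μ⟩)
  | ⟨.loop b c :: k, μ⟩ => PMF.pure (if b.Holds μ then ⟨c :: .loop b c :: k, μ⟩ else ⟨k, μ⟩)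

/-- The distribution of the configuration after `t` steps. -/
def run (M : Oracle) : ℕ → Config → PMF Config
  | 0, C => PMF.pure C
  | t + 1, C => (step M C).bind (run M t)

/-- The initial configuration: the input word is on stack `0`, all other stacks are empty. -/
def start (N : Prog) (input : List ℝ) : Config :=
  ⟨[N], Function.update (fun _ => []) 0 input⟩

def Halted (C : Config) : Prop := C.code = []

/-- The output is the content of stack `1`. -/
def output (C : Config) : List ℝ := C.mem 1

/-- The next step of `C` is an oracle call on the word `w`. -/
def Calls (C : Config) (w : List ℝ) : Prop :=
  ∃ q a k, C.code = Prog.call q a :: k ∧ C.mem q = w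

end Config

/-- Polynomial-time randomized approximation-preserving Turing reducibility from `P` to `Q`. The
program and the polynomials `p`, `q` depend on neither the oracle nor the input. -/
def APTReduces (P Q : MaxProblem) : Prop :=
  ∃ (N : Prog) (p q : MvPolynomial (Fin 2) ℝ),
    ∀ M : Oracle, IsRandomizedApproxScheme Q M →
    ∀ (x : P.Inst) (ε : ℝ), 0 < ε → ε < 1 →
      -- every oracle call is of the form `(w, δ)` with `w` an instance of `Q`, `0 < δ < 1` and
      -- `1 / δ ≤ p(|x|, 1/ε)`
      (∀ (t : ℕ), ∀ C ∈ (Config.run M t (Config.start N (ε :: P.encInst x))).support,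
        ∀ w, C.Calls w → ∃ (v : Q.Inst) (δ : ℝ), w = δ :: Q.encInst v ∧ 0 < δ ∧ δ < 1 ∧
          1 / δ ≤ MvPolynomial.eval ![P.size x, 1 / ε] p) ∧
      -- within `q(|x|, 1/ε)` steps the machine halts on every computation path, and its output
      -- is a `2^ε`-approximate solution with probability at least `3/4`
      ∃ T : ℕ, (T : ℝ) ≤ MvPolynomial.eval ![P.size x, 1 / ε] q ∧
        (∀ C ∈ (Config.run M T (Config.start N (ε :: P.encInst x))).support, C.Halted) ∧
        (3 / 4 : ℝ≥0∞) ≤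
          ((Config.run M T (Config.start N (ε :: P.encInst x))).map Config.output).toOuterMeasure
            (P.goodOutputs x ε)

/-! ### The problems MAX-PROD-CSP -/

/-- Self-delimiting encoding of a list of words: every word is preceded by `1`, and `0` marks
the end. -/
def encList : List (List ℝ) → List ℝ
  | [] => [0]
  | w :: l => 1 :: (w ++ encList l)

/-- A bit as a real number. -/
def encBit (b : Bool) : ℝ := if b then 1 else 0

/-- An applied constraint is written as the list of the indices of its variables, followed by the
list of its values. -/
def Constraint.Applied.enc {n : ℕ} (a : Constraint.Applied n) : List ℝ :=
  encList (List.ofFn (fun i => [((a.scope i : ℕ) : ℝ)])) ++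
    encList ((Constraint.table a.con.arity a.con.val).map (fun r => [(r : ℝ)]))

/-- An instance of MAX-PROD-CSP(`F`): a number `n` of Boolean variables and finitely many
constraints from `F` applied to these variables. -/
structure CSPInstance (F : Set Constraint) where
  n : ℕ
  cons : List (Constraint.Applied n)
  mem : ∀ a ∈ cons, a.con ∈ F

/-- The number `n` of variables is written in unary, and is followed by the list of constraints. -/
def CSPInstance.enc {F : Set Constraint} (x : CSPInstance F) : List ℝ :=
  encList (List.replicate x.n []) ++ encList (x.cons.map Constraint.Applied.enc)

/-- MAX-PROD-CSP(`F`): the solutions are the truth assignments to the variables, and the measure is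
the product of the values of the constraints. -/
def MaxProdCSP (F : Set Constraint) : MaxProblem where
  Inst := CSPInstance F
  Sol x := Fin x.n → Bool
  measure x σ := Constraint.prodEval x.cons σ
  encInst := CSPInstance.enc
  encSol _ σ := List.ofFn (fun i => encBit (σ i))

/-- MAX-PROD-CSP*(`F`): all unary constraints may be used in addition. -/
def MaxProdCSPStar (F : Set Constraint) : MaxProblem := MaxProdCSP (F ∪ Constraint.unary)

end

/-! Sending each variable of `f` to one of two variables or to a constant yields binary constraints
(a, b, c, d). One of them has a, b, d ≠ 0 and bc < ad, or four nonzero entries and ad < bc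
(`exists_binary`). Suppose not, with R_f nonempty. Then a, b, d ≠ 0 always forces c ≠ 0. Since R_f
has a least element l and a greatest element u, this makes R_f closed under complementation inside
[l, u]. An implication between two variables that do not agree on R_f then already follows from
fixed values, so R_f is given by fixing and identifying variables (`exists_isFixIdentify`) and is
affine. The identity ad = bc on full patterns makes `f` log-modular on R_f, hence a product of unary
constraints and EQ (`IsFixIdentify.mem_ED`). Both contradict the hypothesis.

Such a binary constraint gives a soft version of Implies (`exists_gadget`). In the first case unary
weights rescale it to (1, 1, δ, 1) with δ < 1. In the second case they produce a soft OR and a soft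
NAND, which are combined through an auxiliary variable standing for the negation of x. Powers push δ
below 1/2.

The reduction replaces each Implies by m copies of the gadget, sharing three fresh variables. Let B
be the product of max(r, 1/r) over the positive entries r of the input word. Then B ≤ 2^|x|, every
nonzero measure of the instance is at least 1/B, and an assignment violating some Implies has new
value at most 2^(-m) B. Every optimal assignment of nonzero measure extends to the fresh variables
with the same value. If 2^m > 2B² and the optimum is nonzero, a 2^ε-approximate solution of the new
instance has value at least 1/(2B) > 2^(-m) B. It therefore violates nothing, and its restriction to
the old variables is 2^ε-approximate (`isApproxSol_restrict`).

No logarithm is computed: the program doubles a number until it exceeds 2B² and writes the gadget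
once per doubling, so m ≤ 2|x| + 2. A single oracle call with the same ε suffices, and the success
probability 3/4 is inherited. The program is verified by a big-step semantics with step bounds
(`Exec`, `Runs`) on sixteen explicit stacks; `run_single_call` transfers the result to the
probabilistic semantics. -/

open scoped NNReal ENNReal

/-! ### Deterministic computations -/

/-- A deterministic computation of `t` steps without oracle calls. -/
inductive Reach (M : Oracle) : ℕ → Config → Config → Prop
  | refl (C : Config) : Reach M 0 C C
  | step {t : ℕ} {C C' D : Config} (hc : ∀ w, ¬ C.Calls w)
      (hs : Config.step M C = PMF.pure C') (h : Reach M t C' D) : Reach M (t + 1) C D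

theorem Reach.trans {M : Oracle} {s t : ℕ} {C D E : Config} (h : Reach M s C D)
    (h' : Reach M t D E) : Reach M (s + t) C E := by
  induction h with
  | refl C => simpa using h'
  | step hc hs _ ih =>
    have := Reach.step hc hs (ih h')
    rwa [Nat.add_right_comm] at this

theorem Reach.run_add {M : Oracle} {s : ℕ} {C D : Config} (h : Reach M s C D) (t : ℕ) :
    Config.run M (s + t) C = Config.run M t D := by
  induction h with
  | refl C => simp
  | step hc hs _ ih =>
    rw [Nat.add_right_comm, Config.run, hs, PMF.pure_bind, ih]

theorem Reach.not_calls {M : Oracle} {s : ℕ} {C D : Config} (h : Reach M s C D) {t : ℕ}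
    (ht : t < s) {E : Config} (hE : E ∈ (Config.run M t C).support) (w : List ℝ) :
    ¬ E.Calls w := by
  induction h generalizing t with
  | refl C => omega
  | step hc hs _ ih =>
    cases t with
    | zero =>
      simp only [Config.run, PMF.support_pure, Set.mem_singleton_iff] at hE
      exact hE ▸ hc w
    | succ t =>
      rw [Config.run, hs, PMF.pure_bind] at hE
      exact ih (by omega) hE

theorem Config.run_halted (M : Oracle) (t : ℕ) (μ : Memory) :
    Config.run M t ⟨[], μ⟩ = PMF.pure ⟨[], μ⟩ := by
  induction t with
  | zero => rfl
  | succ t ih => rw [Config.run, Config.step, PMF.pure_bind, ih]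

/-- Big-step semantics of programs without oracle calls and coin tosses, with the exact number of
steps. -/
inductive Exec : Prog → Memory → Memory → ℕ → Prop
  | skip (μ : Memory) : Exec .skip μ μ 1
  | const (s : ℕ) (r : ℝ) (μ : Memory) : Exec (.const s r) μ (μ.push s r) 1
  | pop (s : ℕ) (μ : Memory) : Exec (.pop s) μ (Function.update μ s (μ s).tail) 1
  | copy (s t : ℕ) (μ : Memory) : Exec (.copy s t) μ (μ.push t (μ.top s)) 1
  | arith (op : ArithOp) (s t u : ℕ) (μ : Memory) :
      Exec (.arith op s t u) μ (μ.push u (op.apply (μ.top s) (μ.top t))) 1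
  | seq {c d : Prog} {μ ν ξ : Memory} {s t : ℕ} (hc : Exec c μ ν s) (hd : Exec d ν ξ t) :
      Exec (.seq c d) μ ξ (s + t + 1)
  | cond_pos {b : Test} {c d : Prog} {μ ν : Memory} {t : ℕ} (hb : b.Holds μ)
      (h : Exec c μ ν t) : Exec (.cond b c d) μ ν (t + 1)
  | cond_neg {b : Test} {c d : Prog} {μ ν : Memory} {t : ℕ} (hb : ¬ b.Holds μ)
      (h : Exec d μ ν t) : Exec (.cond b c d) μ ν (t + 1)
  | loop_done {b : Test} {c : Prog} {μ : Memory} (hb : ¬ b.Holds μ) : Exec (.loop b c) μ μ 1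
  | loop_step {b : Test} {c : Prog} {μ ν ξ : Memory} {s t : ℕ} (hb : b.Holds μ)
      (hc : Exec c μ ν s) (h : Exec (.loop b c) ν ξ t) : Exec (.loop b c) μ ξ (s + t + 1)

/-- The continuation `k` is arbitrary because `seq` and `loop` push code in front of the remaining
code; the pieces then chain by `Reach.trans`. -/
theorem Exec.reach {c : Prog} {μ ν : Memory} {t : ℕ} (h : Exec c μ ν t) (M : Oracle)
    (k : List Prog) : Reach M t ⟨c :: k, μ⟩ ⟨k, ν⟩ := by
  induction h generalizing k with
  | skip | const | pop | copy | arith =>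
    exact Reach.step (by rintro w ⟨q, a, k, h, -⟩; simp at h) (by simp only [Config.step])
      (Reach.refl _)
  | seq _ _ ihc ihd =>
    exact Reach.step (by rintro w ⟨q, a, k, h, -⟩; simp at h) (by simp only [Config.step])
      ((ihc _).trans (ihd k))
  | cond_pos hb _ ih | cond_neg hb _ ih =>
    exact Reach.step (by rintro w ⟨q, a, k, h, -⟩; simp at h)
      (by simp only [Config.step, hb, if_true, if_false]) (ih k)
  | loop_done hb =>
    exact Reach.step (by rintro w ⟨q, a, k, h, -⟩; simp at h)
      (by simp only [Config.step, hb, if_false]) (Reach.refl _)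
  | loop_step hb _ _ ihc ihl =>
    exact Reach.step (by rintro w ⟨q, a, k, h, -⟩; simp at h)
      (by simp only [Config.step, hb, if_true]) ((ihc _).trans (ihl k))

/-- The program `c` transforms the memory `μ` into `ν` within `T` steps, without oracle calls and
coin tosses. -/
def Runs (c : Prog) (μ ν : Memory) (T : ℕ) : Prop := ∃ t ≤ T, Exec c μ ν t

namespace Runs

variable {b : Test} {c d : Prog} {μ ν ξ : Memory} {S T : ℕ}

theorem mono (h : Runs c μ ν S) (hST : S ≤ T) : Runs c μ ν T := by
  obtain ⟨t, ht, h⟩ := h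
  exact ⟨t, ht.trans hST, h⟩

theorem seq (hc : Runs c μ ν S) (hd : Runs d ν ξ T) : Runs (.seq c d) μ ξ (S + T + 1) := by
  obtain ⟨s, hs, hc⟩ := hc
  obtain ⟨t, ht, hd⟩ := hd
  exact ⟨_, by omega, hc.seq hd⟩

theorem cond_pos (hb : b.Holds μ) (h : Runs c μ ν T) : Runs (.cond b c d) μ ν (T + 1) := by
  obtain ⟨t, ht, h⟩ := h
  exact ⟨_, by omega, h.cond_pos hb⟩

theorem cond_neg (hb : ¬ b.Holds μ) (h : Runs d μ ν T) : Runs (.cond b c d) μ ν (T + 1) := by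
  obtain ⟨t, ht, h⟩ := h
  exact ⟨_, by omega, h.cond_neg hb⟩

theorem loop_done (hb : ¬ b.Holds μ) : Runs (.loop b c) μ μ 1 := ⟨1, le_rfl, .loop_done hb⟩

theorem loop_step (hb : b.Holds μ) (hc : Runs c μ ν S) (h : Runs (.loop b c) ν ξ T) :
    Runs (.loop b c) μ ξ (S + T + 1) := by
  obtain ⟨s, hs, hc⟩ := hc
  obtain ⟨t, ht, h⟩ := h
  exact ⟨_, by omega, .loop_step hb hc h⟩

end Runs

/-! ### Straight-line programs on finitely many stacks -/

/-- The memory whose first stacks are the given ones, and whose other stacks are empty. -/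
def mem (l : List (List ℝ)) : Memory := fun s => l.getD s []

theorem update_mem {l : List (List ℝ)} {s : ℕ} (hs : s < l.length) (w : List ℝ) :
    Function.update (mem l) s w = mem (l.set s w) := by
  funext t
  by_cases h : t = s
  · subst h; simp [mem, hs]
  · simp [mem, h, List.getD_eq_getElem?_getD, Ne.symm h]

namespace Prog

/-- Sequential composition of a list of programs. -/
def block : List Prog → Prog
  | [] => .skip
  | [c] => c
  | c :: d :: l => .seq c (block (d :: l))

/-- Straight-line programs that use only stacks below `n`. -/
def straight (n : ℕ) : Prog → Bool
  | .skip => true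
  | .const s _ => decide (s < n)
  | .pop s => decide (s < n)
  | .copy _ t => decide (t < n)
  | .arith _ _ _ u => decide (u < n)
  | .seq c d => straight n c && straight n d
  | _ => false

/-- The effect of a straight-line program. -/
noncomputable def effect : Prog → List (List ℝ) → List (List ℝ)
  | .const s r, l => l.set s (r :: l.getD s [])
  | .pop s, l => l.set s (l.getD s []).tail
  | .copy s t, l => l.set t ((l.getD s []).headD 0 :: l.getD t [])
  | .arith op s t u, l =>
      l.set u (op.apply ((l.getD s []).headD 0) ((l.getD t []).headD 0) :: l.getD u [])
  | .seq c d, l => effect d (effect c l)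
  | _, l => l

/-- The number of steps of a straight-line program. -/
def cost : Prog → ℕ
  | .seq c d => cost c + cost d + 1
  | _ => 1

theorem length_effect (c : Prog) (l : List (List ℝ)) : (c.effect l).length = l.length := by
  induction c generalizing l with
  | seq c d ihc ihd => rw [effect, ihd, ihc]
  | _ => simp [effect]

end Prog

theorem Exec.straight {c : Prog} {l : List (List ℝ)} (h : c.straight l.length = true) :
    Exec c (mem l) (mem (c.effect l)) c.cost := by
  induction c generalizing l with
  | skip => exact Exec.skip _
  | const s r =>
    have := Exec.const s r (mem l)
    rwa [Memory.push, update_mem (by simpa [Prog.straight] using h)] at this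
  | pop s =>
    have := Exec.pop s (mem l)
    rwa [update_mem (by simpa [Prog.straight] using h)] at this
  | copy s t =>
    have := Exec.copy s t (mem l)
    rwa [Memory.push, update_mem (by simpa [Prog.straight] using h)] at this
  | arith op s t u =>
    have := Exec.arith op s t u (mem l)
    rwa [Memory.push, update_mem (by simpa [Prog.straight] using h)] at this
  | seq c d ihc ihd =>
    simp only [Prog.straight, Bool.and_eq_true] at h
    exact (ihc h.1).seq (ihd (by rw [Prog.length_effect]; exact h.2))
  | _ => simp [Prog.straight] at h

/-- On an explicit list of stacks, `straight`, `effect` and `cost` evaluate even when the contents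
are variables, so most uses are closed by three `rfl`s. -/
theorem Runs.straight {c : Prog} {l l' : List (List ℝ)} {T : ℕ}
    (h : c.straight l.length = true) (hl : c.effect l = l') (hT : c.cost = T) :
    Runs c (mem l) (mem l') T := ⟨c.cost, hT.le, hl ▸ Exec.straight h⟩

/-! ### Moving and erasing stacks -/

namespace Prog

/-- Erase stack `s`. -/
def clear (s : ℕ) : Prog := .loop (.nonempty s) (.pop s)

/-- Move the content of stack `s` to stack `t`, which reverses it. -/
def move (s t : ℕ) : Prog := .loop (.nonempty s) (.seq (.copy s t) (.pop s))

end Prog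

theorem Runs.clear (s : ℕ) (μ : Memory) :
    Runs (Prog.clear s) μ (Function.update μ s []) (2 * (μ s).length + 1) := by
  generalize hw : μ s = w
  induction w generalizing μ with
  | nil =>
    have : Function.update μ s [] = μ := by rw [← hw, Function.update_eq_self]
    rw [this]
    exact Runs.loop_done (by simp [Test.Holds, hw])
  | cons r w ih =>
    have h1 : Runs (.pop s) μ (Function.update μ s w) 1 := by
      have := Exec.pop s μ
      rw [hw] at this
      exact ⟨1, le_rfl, this⟩
    have h2 := ih (Function.update μ s w) (by simp)
    rw [Function.update_idem] at h2
    exact (Runs.loop_step (by simp [Test.Holds, hw]) h1 h2).mono (by simp; omega)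

theorem Runs.move {s t : ℕ} (hst : s ≠ t) (μ : Memory) :
    Runs (Prog.move s t) μ (Function.update (Function.update μ s []) t ((μ s).reverse ++ μ t))
      (4 * (μ s).length + 1) := by
  generalize hw : μ s = w
  induction w generalizing μ with
  | nil =>
    have : Function.update (Function.update μ s []) t ([].reverse ++ μ t) = μ := by
      rw [← hw, Function.update_eq_self]; simp [hw]
    rw [this]
    exact Runs.loop_done (by simp [Test.Holds, hw])
  | cons r w ih =>
    set ν := Function.update (Function.update μ t (r :: μ t)) s w with hν
    have h1 : Runs (.seq (.copy s t) (.pop s)) μ ν 3 := by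
      have := (Exec.copy s t μ).seq (Exec.pop s _)
      simp only [Memory.push, Memory.top, hw, List.headD_cons, ne_eq, hst, not_false_eq_true,
        Function.update_of_ne, List.tail_cons] at this
      exact ⟨3, le_rfl, this⟩
    have h2 := ih ν (by simp [hν])
    have h3 : Function.update (Function.update ν s []) t (w.reverse ++ ν t) =
        Function.update (Function.update μ s []) t ((r :: w).reverse ++ μ t) := by
      funext u
      by_cases hu : u = t
      · subst hu; simp [hν, hst.symm]
      · by_cases hu' : u = s
        · subst hu'; simp [hu]
        · simp [hν, hu, hu']
    rw [h3] at h2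
    exact (Runs.loop_step (by simp [Test.Holds, hw]) h1 h2).mono (by simp; omega)

theorem Runs.clear_mem {s : ℕ} {l l' : List (List ℝ)} {w : List ℝ}
    (hs : decide (s < l.length) = true) (hw : l.getD s [] = w) (hl : l.set s [] = l') :
    Runs (Prog.clear s) (mem l) (mem l') (2 * w.length + 1) := by
  have := Runs.clear s (mem l)
  rwa [update_mem (of_decide_eq_true hs), hl, mem, hw] at this

theorem Runs.move_mem {s t : ℕ} {l l' : List (List ℝ)} {w : List ℝ} (hst : s ≠ t)
    (hs : decide (s < l.length) = true) (ht : decide (t < l.length) = true)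
    (hw : l.getD s [] = w) (hl : (l.set s []).set t (w.reverse ++ l.getD t []) = l') :
    Runs (Prog.move s t) (mem l) (mem l') (4 * w.length + 1) := by
  have := Runs.move hst (mem l)
  rw [update_mem (of_decide_eq_true hs), update_mem (by simpa using ht)] at this
  simp only [mem, hw] at this
  exact hl ▸ this

/-! ### Encodings of applied constraints -/

/-- A constraint applied to variables that are given by their indices. -/
structure RawApplied where
  con : Constraint
  scope : Fin con.arity → ℕ

/-- The encoding of a list of numbers. -/
def tagged (l : List ℝ) : List ℝ := encList (l.map (fun r => [r]))

theorem tagged_cons (r : ℝ) (l : List ℝ) : tagged (r :: l) = 1 :: r :: tagged l := rfl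

theorem tagged_eq (l : List ℝ) : tagged l = l.flatMap (fun r => [1, r]) ++ [0] := by
  induction l with
  | nil => rfl
  | cons r l ih => rw [tagged_cons, ih]; rfl

theorem length_tagged (l : List ℝ) : (tagged l).length = 2 * l.length + 1 := by
  induction l with
  | nil => rfl
  | cons r l ih => rw [tagged_cons]; simp [ih]; omega

theorem encList_append (l l' : List (List ℝ)) :
    encList (l ++ l') = l.flatMap (fun w => 1 :: w) ++ encList l' := by
  induction l with
  | nil => rfl
  | cons w l ih => simp [encList, ih]

namespace RawApplied

/-- The indices of the variables. -/
def indices (a : RawApplied) : List ℝ := List.ofFn (fun i => (a.scope i : ℝ))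

/-- The values of the constraint. -/
def values (a : RawApplied) : List ℝ :=
  (Constraint.table a.con.arity a.con.val).map (fun r : ℝ≥0 => (r : ℝ))

def enc (a : RawApplied) : List ℝ := tagged a.indices ++ tagged a.values

theorem enc_eq (a : RawApplied) : a.enc =
    encList (List.ofFn (fun i => [(a.scope i : ℝ)])) ++
      encList ((Constraint.table a.con.arity a.con.val).map (fun r => [(r : ℝ)])) := by
  simp only [enc, tagged, indices, values, List.map_ofFn, List.bind_eq_flatMap, List.pure_def,
    ← List.map_eq_flatMap]
  rfl

theorem length_enc (a : RawApplied) :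
    a.enc.length = 2 * a.indices.length + 2 * a.values.length + 2 := by
  simp only [enc, List.length_append, length_tagged]; omega

end RawApplied

theorem Constraint.length_table (k : ℕ) (g : (Fin k → Bool) → ℝ≥0) :
    (Constraint.table k g).length = 2 ^ k := by
  induction k with
  | zero => rfl
  | succ k ih => simp [Constraint.table, ih]; ring

theorem Constraint.table_two (g : (Fin 2 → Bool) → ℝ≥0) :
    Constraint.table 2 g =
      [g ![false, false], g ![false, true], g ![true, false], g ![true, true]] := by
  have h : ∀ a b : Bool,
      (Fin.cons a (Fin.cons b Fin.elim0 : Fin 1 → Bool) : Fin 2 → Bool) = ![a, b] := by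
    intro a b; funext i; fin_cases i <;> rfl
  simp only [Constraint.table, List.cons_append, List.nil_append]
  exact congrArg₂ _ (congrArg g (h _ _)) (congrArg₂ _ (congrArg g (h _ _))
    (congrArg₂ _ (congrArg g (h _ _)) (congrArg₂ _ (congrArg g (h _ _)) rfl)))

/-- The machine sees only the table of values, yet this suffices to recognize Implies: a table of
length 4 = 2^k forces arity 2. The list is reversed because reading it onto a stack reverses it. -/
theorem RawApplied.values_eq_iff (a : RawApplied) :
    a.values.reverse = [1, 0, 1, 1] ↔ a.con = Constraint.implies := by
  obtain ⟨⟨k, g⟩, s⟩ := a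
  simp only [RawApplied.values]
  constructor
  · intro h
    have hk : 2 ^ k = 2 ^ 2 := by
      have := congrArg List.length h
      simpa [Constraint.length_table] using this
    obtain rfl : k = 2 := Nat.pow_right_injective le_rfl hk
    rw [Constraint.table_two] at h
    simp only [List.map_cons, List.map_nil, List.reverse_cons, List.reverse_nil, List.nil_append,
      List.cons_append, List.cons.injEq, and_true, NNReal.coe_eq_one, NNReal.coe_eq_zero] at h
    obtain ⟨h11, h10, h01, h00⟩ := h
    rw [Constraint.implies]
    congr 1
    funext x
    have hx : x = ![x 0, x 1] := by funext i; fin_cases i <;> rfl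
    rw [hx]
    cases x 0 <;> cases x 1 <;> simp [*]
  · intro h
    cases h
    rw [Constraint.table_two]
    simp

/-! ### The program -/

namespace Reduction

/-- Symbols to be written: constants, or the content of one of the stacks `10`, …, `14`. -/
abbrev Sym := ℝ ⊕ Fin 5

/-- The word of symbols that encodes an applied constraint. -/
def symbols (a : Constraint.Applied 5) : List Sym :=
  (List.ofFn a.scope).flatMap (fun v => [.inl 1, .inr v]) ++ .inl 0 ::
    ((Constraint.table a.con.arity a.con.val).flatMap (fun r => [.inl 1, .inl (r : ℝ)]) ++ [.inl 0])

/-- The words of symbols for a list of applied constraints. -/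
def symbolsList (G : List (Constraint.Applied 5)) : List Sym :=
  G.flatMap (fun a => .inl 1 :: symbols a)

/-- Write the symbols on stack `9`. -/
def emit : List Sym → Prog
  | [] => .skip
  | .inl r :: ys => .seq (emit ys) (.const 9 r)
  | .inr v :: ys => .seq (emit ys) (.copy (10 + v) 9)

/-- Read a list of numbers from stack `0`, copy its encoding to stack `3` and its entries to
stack `s`. -/
def readTagged (s : ℕ) : Prog :=
  .seq (.loop (.le 5 0) (.block [.copy 0 3, .pop 0, .copy 0 3, .copy 0 s, .pop 0]))
    (.block [.copy 0 3, .pop 0])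

/-- Erase stack `14`, and raise the flag on stack `13` if its content was the given word. -/
def matchWord : List ℝ → Prog
  | [] => .cond (.nonempty 14) (.clear 14) (.const 13 1)
  | r :: p => .cond (.nonempty 14)
      (.seq (.const 6 r) (.cond (.le 14 6)
        (.cond (.le 6 14) (.seq (.block [.pop 6, .pop 14]) (matchWord p))
          (.seq (.pop 6) (.clear 14)))
        (.seq (.pop 6) (.clear 14)))) .skip

def copyItem : Prog := .seq (.clear 15) (.seq (.move 3 9) (.const 9 1))

/-- Stack 6 holds a power of two and stack 4 the threshold 2B². The number m of copies is never
stored; it is the number of doublings. -/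
def gadgetLoop (G : List (Constraint.Applied 5)) : Prog :=
  .loop (.le 6 4) (.seq (emit (symbolsList G)) (.block [.arith .add 6 6 3, .pop 6, .copy 3 6, .pop 3]))

def replaceItem (G : List (Constraint.Applied 5)) : Prog :=
  .seq (.clear 3) (.seq
    (.block [.pop 13, .copy 15 11, .pop 15, .copy 15 10, .pop 15, .arith .add 12 5 13,
      .arith .add 13 5 14, .const 6 1])
    (.seq (gadgetLoop G)
      (.block [.pop 6, .arith .add 14 5 6, .pop 12, .copy 6 12, .pop 6, .pop 13, .pop 14, .pop 10,
        .pop 11, .const 7 1, .const 7 1, .const 7 1])))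

/-- Use of the stacks: 0 input, 1 output, 2 ε, 4 threshold, 5 the constant 1, 7 and 8 the new and
the old number of variables in unary, 9 the query, 12 the next free index; 3 and 6 are scratch.
Stacks 15 and 14 receive indices and values and 13 the flag for Implies. While a gadget is written,
10, 11, 12, 13, 14 hold i, j, c, c + 1, c + 2. -/
def item (G : List (Constraint.Applied 5)) : Prog :=
  .seq (.pop 0) (.seq (readTagged 15) (.seq (readTagged 14) (.seq (matchWord [1, 0, 1, 1])
    (.cond (.nonempty 13) (replaceItem G) copyItem))))

def items (G : List (Constraint.Applied 5)) : Prog := .loop (.le 5 0) (item G)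

/-- Move the word on stack `0` to stack `3`, and compute on stack `4` the product of its positive
entries, or of their inverses if these are larger. -/
def scan : Prog :=
  .loop (.nonempty 0) (.seq (.copy 0 3) (.seq
    (.cond (.le 0 1) .skip (.seq (.cond (.le 0 5) (.arith .div 4 0 6) (.arith .mul 4 0 6))
      (.block [.pop 4, .copy 6 4, .pop 6])))
    (.pop 0)))

def readUnary : Prog :=
  .loop (.le 5 0)
    (.block [.const 7 1, .const 8 1, .pop 0, .arith .add 12 5 6, .pop 12, .copy 6 12, .pop 6])

/-- The program up to the oracle call. -/
def query (G : List (Constraint.Applied 5)) : Prog :=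
  .seq (.block [.copy 0 2, .pop 0, .const 5 1, .const 4 1]) (.seq scan (.seq (.move 3 0) (.seq
    -- Stack 4 passes from B to 2B². The query on stack 9 is built from its end: first the end
    -- marker of the list of constraints, then the constraints, the unary number of variables, and
    -- finally ε.
    (.block [.arith .mul 4 4 6, .pop 4, .arith .add 6 6 4, .pop 6, .const 12 0]) (.seq readUnary
      (.seq (.block [.pop 0, .const 9 0]) (.seq (items G) (.seq (.const 9 0) (.seq (.move 7 9)
        (.copy 2 9)))))))))

/-- The loop is driven by the n ones on stack 8, not by the answer, so the running time is bounded
even if the oracle returns an arbitrarily long word; a short one is padded with zeros. -/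
def takeAnswer : Prog := .loop (.nonempty 8) (.block [.copy 3 6, .pop 3, .pop 8])

/-- The program after the oracle call: the first entries of the answer are the output. -/
def answer : Prog := .seq takeAnswer (.move 6 1)

def program (G : List (Constraint.Applied 5)) : Prog := .seq (query G) (.seq (.call 9 3) answer)

/-! ### Correctness of the parts of the program -/

/-- The values of the symbols. -/
def symVal (i j c : ℝ) : Sym → ℝ := Sum.elim id ![i, j, c, c + 1, c + 1 + 1]

theorem runs_emit (ys : List Sym) (i j c : ℝ) (a0 a1 a2 a3 a4 a5 a6 a7 a8 a9 a15 : List ℝ) :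
    Runs (emit ys)
      (mem [a0, a1, a2, a3, a4, a5, a6, a7, a8, a9, [i], [j], [c], [c + 1], [c + 1 + 1], a15])
      (mem [a0, a1, a2, a3, a4, a5, a6, a7, a8, ys.map (symVal i j c) ++ a9,
        [i], [j], [c], [c + 1], [c + 1 + 1], a15]) (2 * ys.length + 1) := by
  induction ys with
  | nil => exact Runs.straight rfl rfl rfl
  | cons y ys ih =>
    cases y with
    | inl r => exact ih.seq (T := 1) (Runs.straight rfl rfl rfl)
    | inr v =>
      refine ih.seq (T := 1) ?_
      fin_cases v <;> exact Runs.straight rfl rfl rfl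

/-- The test compares 1 with the top of stack 0 only when a marker is there, so the entries
themselves may be arbitrary reals. -/
theorem runs_readTagged_indices (l R A D a1 a2 a4 a6 a7 a8 a9 a10 a11 a12 a13 a14 : List ℝ) :
    Runs (readTagged 15)
      (mem [tagged l ++ R, a1, a2, A, a4, [1], a6, a7, a8, a9, a10, a11, a12, a13, a14, D])
      (mem [R, a1, a2, (tagged l).reverse ++ A, a4, [1], a6, a7, a8, a9, a10, a11, a12, a13, a14,
        l.reverse ++ D]) (10 * l.length + 5) := by
  refine Runs.seq (S := 10 * l.length + 1) (T := 3) (ν := mem [0 :: R, a1, a2,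
    (l.flatMap (fun r => [1, r])).reverse ++ A, a4, [1], a6, a7, a8, a9, a10, a11, a12, a13, a14,
    l.reverse ++ D]) ?_ ?_
  · induction l generalizing A D with
    | nil => exact Runs.loop_done (show ¬ (1 : ℝ) ≤ 0 by norm_num)
    | cons r l ih =>
      have := ih (r :: 1 :: A) (r :: D)
      simp only [List.flatMap_cons, List.reverse_cons, List.nil_append, List.cons_append,
        List.append_assoc, tagged_cons]
      exact Runs.mono (Runs.loop_step (S := 9) (show (1 : ℝ) ≤ 1 from le_rfl)
        (Runs.straight rfl rfl rfl) this) (by simp only [List.length_cons]; omega)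
  · rw [tagged_eq]
    simp only [List.reverse_append, List.reverse_cons, List.reverse_nil, List.nil_append,
      List.cons_append]
    exact Runs.straight rfl rfl rfl

theorem runs_readTagged_values (l R A D a1 a2 a4 a6 a7 a8 a9 a10 a11 a12 a13 a15 : List ℝ) :
    Runs (readTagged 14)
      (mem [tagged l ++ R, a1, a2, A, a4, [1], a6, a7, a8, a9, a10, a11, a12, a13, D, a15])
      (mem [R, a1, a2, (tagged l).reverse ++ A, a4, [1], a6, a7, a8, a9, a10, a11, a12, a13, l.reverse ++ D,
        a15]) (10 * l.length + 5) := by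
  refine Runs.seq (S := 10 * l.length + 1) (T := 3) (ν := mem [0 :: R, a1, a2,
    (l.flatMap (fun r => [1, r])).reverse ++ A, a4, [1], a6, a7, a8, a9, a10, a11, a12, a13, l.reverse ++ D,
    a15]) ?_ ?_
  · induction l generalizing A D with
    | nil => exact Runs.loop_done (show ¬ (1 : ℝ) ≤ 0 by norm_num)
    | cons r l ih =>
      have := ih (r :: 1 :: A) (r :: D)
      simp only [List.flatMap_cons, List.reverse_cons, List.nil_append, List.cons_append,
        List.append_assoc, tagged_cons]
      exact Runs.mono (Runs.loop_step (S := 9) (show (1 : ℝ) ≤ 1 from le_rfl)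
        (Runs.straight rfl rfl rfl) this) (by simp only [List.length_cons]; omega)
  · rw [tagged_eq]
    simp only [List.reverse_append, List.reverse_cons, List.reverse_nil, List.nil_append,
      List.cons_append]
    exact Runs.straight rfl rfl rfl

-- Equality of reals is decided by two comparisons. A mismatch or a surplus of entries clears stack
-- 14 without raising the flag, and a missing entry just stops.
open scoped Classical in
theorem runs_matchWord (p w a0 a1 a2 a3 a4 a5 a7 a8 a9 a10 a11 a12 a15 : List ℝ) :
    Runs (matchWord p)
      (mem [a0, a1, a2, a3, a4, a5, [], a7, a8, a9, a10, a11, a12, [], w, a15])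
      (mem [a0, a1, a2, a3, a4, a5, [], a7, a8, a9, a10, a11, a12, if w = p then [1] else [], [],
        a15]) (10 * p.length + 2 * w.length + 8) := by
  induction p generalizing w with
  | nil =>
    cases w with
    | nil =>
      exact Runs.mono (Runs.cond_neg (T := 1) (fun h : ([] : List ℝ) ≠ [] => h rfl)
        (Runs.straight rfl (by simp; rfl) rfl)) (by omega)
    | cons r w =>
      exact Runs.mono (Runs.cond_pos (List.cons_ne_nil r w)
        (Runs.clear_mem rfl rfl (by simp))) (by simp)
  | cons r p ih =>
    cases w with
    | nil =>
      exact Runs.mono (Runs.cond_neg (T := 1) (fun h : ([] : List ℝ) ≠ [] => h rfl)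
        (Runs.straight rfl (by simp; rfl) rfl)) (by omega)
    | cons r' w =>
      refine Runs.mono (Runs.cond_pos (List.cons_ne_nil r' w) (Runs.seq (S := 1)
        (T := 10 * p.length + 2 * w.length + 14)
        (ν := mem [a0, a1, a2, a3, a4, a5, [r], a7, a8, a9, a10, a11, a12, [], r' :: w, a15])
        (Runs.straight rfl rfl rfl) ?_)) (by simp; omega)
      have hclear : r' ≠ r → Runs (.seq (.pop 6) (.clear 14))
          (mem [a0, a1, a2, a3, a4, a5, [r], a7, a8, a9, a10, a11, a12, [], r' :: w, a15])
          (mem [a0, a1, a2, a3, a4, a5, [], a7, a8, a9, a10, a11, a12,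
            if r' :: w = r :: p then [1] else [], [], a15]) (2 * w.length + 5) := by
        intro hne
        rw [if_neg (by simp [hne])]
        exact Runs.mono (Runs.seq (S := 1) (Runs.straight rfl rfl rfl)
          (Runs.clear_mem (l := [a0, a1, a2, a3, a4, a5, [], a7, a8, a9, a10, a11, a12, [],
            r' :: w, a15]) rfl rfl rfl)) (by simp; omega)
      by_cases h1 : r' ≤ r
      · refine Runs.mono (Runs.cond_pos (T := 10 * p.length + 2 * w.length + 13)
          (show r' ≤ r from h1) ?_) (by omega)
        by_cases h2 : r ≤ r'
        · obtain rfl := le_antisymm h1 h2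
          have := ih w
          simp only [List.cons.injEq, true_and]
          exact Runs.mono (Runs.cond_pos (show r' ≤ r' from h2)
            (Runs.seq (S := 3) (Runs.straight rfl rfl rfl) this)) (by omega)
        · exact Runs.mono (Runs.cond_neg (show ¬ r ≤ r' from h2)
            (hclear (fun h => h2 h.ge))) (by omega)
      · exact Runs.mono (Runs.cond_neg (show ¬ r' ≤ r from h1)
          (hclear (fun h => h1 h.le))) (by omega)

theorem runs_copyItem (A I a0 a1 a2 a4 a5 a6 a7 a8 a9 a10 a11 a12 a13 a14 : List ℝ) :
    Runs copyItem
      (mem [a0, a1, a2, A.reverse, a4, a5, a6, a7, a8, a9, a10, a11, a12, a13, a14, I])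
      (mem [a0, a1, a2, [], a4, a5, a6, a7, a8, 1 :: A ++ a9, a10, a11, a12, a13, a14, []])
      (2 * I.length + 4 * A.length + 5) := by
  refine Runs.mono (Runs.seq (Runs.clear_mem rfl rfl rfl) (Runs.seq (T := 1)
    (ν := mem [a0, a1, a2, [], a4, a5, a6, a7, a8, A ++ a9, a10, a11, a12, a13, a14, []])
    (Runs.move_mem (by decide) rfl rfl rfl (by simp)) (Runs.straight rfl rfl rfl)))
    (by simp; omega)

/-- The hypotheses on `P` and `b` say that exactly `m` doublings carry `P` beyond `b`; the induction
passes from `P` to `P + P`. -/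
theorem runs_gadgetLoop (G : List (Constraint.Applied 5)) (m : ℕ) (P b i j c : ℝ)
    (hlow : ∀ k < m, P * 2 ^ k ≤ b) (hhigh : b < P * 2 ^ m)
    (a0 a1 a2 a5 a7 a8 a9 a15 : List ℝ) :
    Runs (gadgetLoop G)
      (mem [a0, a1, a2, [], [b], a5, [P], a7, a8, a9, [i], [j], [c], [c + 1], [c + 1 + 1], a15])
      (mem [a0, a1, a2, [], [b], a5, [P * 2 ^ m], a7, a8,
        (List.replicate m ((symbolsList G).map (symVal i j c))).flatten ++ a9,
        [i], [j], [c], [c + 1], [c + 1 + 1], a15])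
      (m * (2 * (symbolsList G).length + 10) + 1) := by
  induction m generalizing P a9 with
  | zero =>
    simp only [pow_zero, mul_one] at hhigh ⊢
    exact Runs.mono (Runs.loop_done (show ¬ P ≤ b from not_le.mpr hhigh)) (by omega)
  | succ m ih =>
    have h0 : P ≤ b := by simpa using hlow 0 (by omega)
    have key := ih (P + P)
      (fun k hk => by have := hlow (k + 1) (by omega); rw [pow_succ] at this; linarith)
      (by rw [pow_succ] at hhigh; linarith)
      ((symbolsList G).map (symVal i j c) ++ a9)
    have hP : (P + P) * 2 ^ m = P * 2 ^ (m + 1) := by ring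
    have hrep : (List.replicate (m + 1) ((symbolsList G).map (symVal i j c))).flatten ++ a9 =
        (List.replicate m ((symbolsList G).map (symVal i j c))).flatten ++
          ((symbolsList G).map (symVal i j c) ++ a9) := by
      simp [List.replicate_succ']
    rw [hP] at key
    rw [hrep]
    exact Runs.mono (Runs.loop_step (show P ≤ b from h0)
      (Runs.seq (T := 7) (runs_emit _ _ _ _ _ _ _ _ _ _ _ _ _ _ _) (Runs.straight rfl rfl rfl)) key)
      (by ring_nf; omega)

theorem runs_replaceItem (G : List (Constraint.Applied 5)) (m : ℕ) (b i j c : ℝ)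
    (hlow : ∀ k < m, (2 : ℝ) ^ k ≤ b) (hhigh : b < 2 ^ m)
    (a0 a1 a2 a3 a7 a8 a9 : List ℝ) :
    Runs (replaceItem G)
      (mem [a0, a1, a2, a3, [b], [1], [], a7, a8, a9, [], [], [c], [1], [], [j, i]])
      (mem [a0, a1, a2, [], [b], [1], [], 1 :: 1 :: 1 :: a7, a8,
        (List.replicate m ((symbolsList G).map (symVal i j c))).flatten ++ a9,
        [], [], [c + 1 + 1 + 1], [], [], []])
      (2 * a3.length + m * (2 * (symbolsList G).length + 10) + 50) := by
  have h := runs_gadgetLoop G m 1 b i j c (by simpa using hlow) (by simpa using hhigh)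
    a0 a1 a2 [1] a7 a8 a9 []
  exact Runs.mono (Runs.seq (Runs.clear_mem rfl rfl rfl) (Runs.seq (S := 15)
    (Runs.straight rfl rfl rfl) (Runs.seq h (Runs.straight rfl rfl rfl)))) (by simp [Prog.cost, Prog.block]; omega)

end Reduction

namespace Reduction

/-! ### The transformation of the list of constraints -/

/-- Apply a constraint on five variables to the variables `i`, `j`, `c`, `c + 1`, `c + 2`. -/
def localize (i j c : ℕ) (a : Constraint.Applied 5) : RawApplied :=
  ⟨a.con, fun k => ![i, j, c, c + 1, c + 1 + 1] (a.scope k)⟩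

/-- The index of variable number `k` of an applied constraint. -/
def index (a : RawApplied) (k : ℕ) : ℕ := (List.ofFn a.scope).getD k 0

open scoped Classical in
/-- The constraints that replace the constraint `a`. -/
noncomputable def replacement (G : List (Constraint.Applied 5)) (m : ℕ) (a : RawApplied) (c : ℕ) :
    List RawApplied :=
  if a.con = Constraint.implies then
    (List.replicate m (G.map (localize (index a 0) (index a 1) c))).flatten
  else [a]

open scoped Classical in
/-- The number of new variables for the constraint `a`. -/
noncomputable def fresh (a : RawApplied) : ℕ := if a.con = Constraint.implies then 3 else 0

/-- Replace every constraint `Implies` by `m` copies of the gadget `G` with three new variables. -/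
noncomputable def transform (G : List (Constraint.Applied 5)) (m : ℕ) :
    List RawApplied → ℕ → List RawApplied → ℕ × List RawApplied
  | [], c, acc => (c, acc)
  | a :: L, c, acc => transform G m L (c + fresh a) (replacement G m a c ++ acc)

/-- The word stored in the program is a template: filling in the five indices gives the encoding of
the localized constraint. -/
theorem symbols_map (a : Constraint.Applied 5) (i j c : ℕ) :
    (symbols a).map (symVal i j c) = (localize i j c a).enc := by
  have h : ∀ v : Fin 5, symVal i j c (.inr v) = ((![i, j, c, c + 1, c + 1 + 1] v : ℕ) : ℝ) := by
    intro v
    fin_cases v <;> simp [symVal]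
  simp only [symbols, RawApplied.enc, tagged_eq, RawApplied.indices, RawApplied.values, localize,
    List.map_append, List.map_flatMap, List.map_cons, List.map_nil, h, List.flatMap_map]
  have h0 : ∀ r : ℝ, symVal i j c (.inl r) = r := fun r => rfl
  simp only [h0, List.append_assoc, List.cons_append, List.nil_append]
  congr 1
  rw [← Function.comp_def (fun n : ℕ => (n : ℝ)), ← Function.comp_def _ a.scope, ← List.map_ofFn,
    ← List.map_ofFn, List.flatMap_map, List.flatMap_map]

theorem symbolsList_map (G : List (Constraint.Applied 5)) (i j c : ℕ) :
    (symbolsList G).map (symVal i j c) =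
      (G.map (localize i j c)).flatMap (fun a => 1 :: a.enc) := by
  simp only [symbolsList, List.map_flatMap, List.map_cons, symbols_map, List.flatMap_map]
  rfl

theorem flatMap_flatten_replicate {α β : Type*} (m : ℕ) (l : List α) (g : α → List β) :
    (List.replicate m l).flatten.flatMap g = (List.replicate m (l.flatMap g)).flatten := by
  induction m with
  | zero => rfl
  | succ m ih => simp [List.replicate_succ, ih]

theorem encList_map_append (l l' : List RawApplied) :
    encList ((l ++ l').map RawApplied.enc) =
      l.flatMap (fun a => 1 :: a.enc) ++ encList (l'.map RawApplied.enc) := by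
  rw [List.map_append, encList_append, List.flatMap_map]

theorem indices_of_implies {a : RawApplied} (h : a.con = Constraint.implies) :
    a.indices = [(index a 0 : ℝ), (index a 1 : ℝ)] := by
  obtain ⟨con, s⟩ := a
  subst h
  change Fin 2 → ℕ at s
  change List.ofFn (fun i : Fin 2 => (s i : ℝ)) =
    [(((List.ofFn s).getD 0 0 : ℕ) : ℝ), (((List.ofFn s).getD 1 0 : ℕ) : ℝ)]
  simp [List.ofFn_succ]

theorem runs_item (G : List (Constraint.Applied 5)) (m : ℕ) (b : ℝ)
    (hlow : ∀ k < m, (2 : ℝ) ^ k ≤ b) (hhigh : b < 2 ^ m) (a : RawApplied) (c : ℕ)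
    (acc : List RawApplied) (R a2 a8 : List ℝ) :
    Runs (item G)
      (mem [1 :: (a.enc ++ R), [], a2, [], [b], [1], [], List.replicate c 1, a8,
        encList (acc.map RawApplied.enc), [], [], [(c : ℝ)], [], [], []])
      (mem [R, [], a2, [], [b], [1], [], List.replicate (c + fresh a) 1, a8,
        encList ((replacement G m a c ++ acc).map RawApplied.enc), [], [],
        [((c + fresh a : ℕ) : ℝ)], [], [], []])
      (20 * a.enc.length + m * (2 * (symbolsList G).length + 10) + 200) := by
  classical
  have h1 := runs_readTagged_indices a.indices (tagged a.values ++ R) [] [] [] a2 [b] []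
    (List.replicate c 1) a8 (encList (acc.map RawApplied.enc)) [] [] [(c : ℝ)] [] []
  have h2 := runs_readTagged_values a.values R ((tagged a.indices).reverse ++ []) [] [] a2 [b] []
    (List.replicate c 1) a8 (encList (acc.map RawApplied.enc)) [] [] [(c : ℝ)] []
    (a.indices.reverse ++ [])
  have h3 := runs_matchWord [1, 0, 1, 1] (a.values.reverse ++ []) R [] a2
    ((tagged a.values).reverse ++ ((tagged a.indices).reverse ++ [])) [b] [1]
    (List.replicate c 1) a8 (encList (acc.map RawApplied.enc)) [] [] [(c : ℝ)]
    (a.indices.reverse ++ [])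
  have h12 : (tagged a.values).reverse ++ ((tagged a.indices).reverse ++ []) = a.enc.reverse := by
    simp [RawApplied.enc]
  rw [h12] at h2 h3
  simp only [List.append_nil] at h1 h2 h3
  have hpop : Runs (.pop 0) (mem [1 :: (a.enc ++ R), [], a2, [], [b], [1], [],
      List.replicate c 1, a8, encList (acc.map RawApplied.enc), [], [], [(c : ℝ)], [], [], []])
      (mem [tagged a.indices ++ (tagged a.values ++ R), [], a2, [], [b], [1], [],
        List.replicate c 1, a8, encList (acc.map RawApplied.enc), [], [], [(c : ℝ)], [], [], []])
      1 := by
    rw [RawApplied.enc, List.append_assoc]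
    exact Runs.straight rfl rfl rfl
  have hlen := a.length_enc
  refine Runs.mono (hpop.seq (h1.seq (h2.seq (h3.seq
    (T := 6 * a.enc.length + m * (2 * (symbolsList G).length + 10) + 60) ?_))))
    (by simp only [List.length_reverse, List.length_cons, List.length_nil]; omega)
  simp only [a.values_eq_iff]
  by_cases himp : a.con = Constraint.implies
  · rw [if_pos himp]
    have h4 := runs_replaceItem G m b (index a 0) (index a 1) c hlow hhigh R [] a2 a.enc.reverse
      (List.replicate c 1) a8 (encList (acc.map RawApplied.enc))
    rw [symbolsList_map, ← flatMap_flatten_replicate, ← encList_map_append] at h4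
    have hidx : a.indices.reverse = [(index a 1 : ℝ), (index a 0 : ℝ)] := by
      rw [indices_of_implies himp]; rfl
    have hc : (c : ℝ) + 1 + 1 + 1 = ((c + fresh a : ℕ) : ℝ) := by
      simp [fresh, himp]; ring
    have hrep : (1 : ℝ) :: 1 :: 1 :: List.replicate c 1 = List.replicate (c + fresh a) 1 := by
      simp [fresh, himp, List.replicate_succ]
    have hR : replacement G m a c =
        (List.replicate m (G.map (localize (index a 0) (index a 1) c))).flatten := by
      simp [replacement, himp]
    rw [hidx, hR, ← hc, ← hrep]
    exact Runs.mono (Runs.cond_pos (List.cons_ne_nil (1 : ℝ) []) h4)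
      (by simp only [List.length_reverse]; omega)
  · rw [if_neg himp]
    have h4 := runs_copyItem a.enc a.indices.reverse R [] a2 [b] [1] [] (List.replicate c 1) a8
      (encList (acc.map RawApplied.enc)) [] [] [(c : ℝ)] [] []
    have hc : fresh a = 0 := by simp [fresh, himp]
    have hR : replacement G m a c = [a] := by simp [replacement, himp]
    rw [hc, hR, encList_map_append]
    simp only [List.flatMap_cons, List.flatMap_nil, List.append_nil, Nat.add_zero]
    exact Runs.mono (Runs.cond_neg (fun h : ([] : List ℝ) ≠ [] => h rfl) h4)
      (by simp only [List.length_reverse]; omega)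

theorem runs_items (G : List (Constraint.Applied 5)) (m : ℕ) (b : ℝ)
    (hlow : ∀ k < m, (2 : ℝ) ^ k ≤ b) (hhigh : b < 2 ^ m) (L : List RawApplied) (c : ℕ)
    (acc : List RawApplied) (a2 a8 : List ℝ) :
    Runs (items G)
      (mem [encList (L.map RawApplied.enc), [], a2, [], [b], [1], [], List.replicate c 1, a8,
        encList (acc.map RawApplied.enc), [], [], [(c : ℝ)], [], [], []])
      (mem [[0], [], a2, [], [b], [1], [], List.replicate (transform G m L c acc).1 1, a8,
        encList ((transform G m L c acc).2.map RawApplied.enc), [], [],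
        [((transform G m L c acc).1 : ℝ)], [], [], []])
      (20 * (encList (L.map RawApplied.enc)).length +
        L.length * (m * (2 * (symbolsList G).length + 10) + 201) + 1) := by
  induction L generalizing c acc with
  | nil =>
    exact Runs.mono (Runs.loop_done (show ¬ (1 : ℝ) ≤ 0 by norm_num)) (by omega)
  | cons a L ih =>
    exact Runs.mono (Runs.loop_step (show (1 : ℝ) ≤ 1 from le_rfl)
      (runs_item G m b hlow hhigh a c acc (encList (L.map RawApplied.enc)) a2 a8)
      (ih (c + fresh a) (replacement G m a c ++ acc)))
      (by simp only [List.map_cons, encList, List.length_cons, List.length_append]; ring_nf; omega)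

/-! ### The remaining parts of the program -/

open scoped Classical in
/-- The effect of one entry of the input on the bound that is computed by `scan`. -/
noncomputable def scale (b r : ℝ) : ℝ := if r ≤ 0 then b else if r ≤ 1 then b / r else b * r

/-- Stack 1 is empty during the scan and reads as 0, so `.le 0 1` is the test r ≤ 0. -/
theorem runs_scan (w A : List ℝ) (b : ℝ) (a2 a7 a8 a9 a10 a11 a12 a13 a14 a15 : List ℝ) :
    Runs scan
      (mem [w, [], a2, A, [b], [1], [], a7, a8, a9, a10, a11, a12, a13, a14, a15])
      (mem [[], [], a2, w.reverse ++ A, [w.foldl scale b], [1], [], a7, a8, a9, a10, a11, a12, a13,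
        a14, a15]) (20 * w.length + 1) := by
  induction w generalizing A b with
  | nil => exact Runs.loop_done (fun h : ([] : List ℝ) ≠ [] => h rfl)
  | cons r w ih =>
    have key := ih (r :: A) (scale b r)
    simp only [List.reverse_cons, List.append_assoc, List.cons_append, List.nil_append,
      List.foldl_cons]
    refine Runs.mono (Runs.loop_step (S := 14) (List.cons_ne_nil r w)
      (Runs.seq (S := 1) (T := 12)
        (ν := mem [r :: w, [], a2, r :: A, [b], [1], [], a7, a8, a9, a10, a11, a12, a13, a14, a15])
        (Runs.straight rfl rfl rfl) (Runs.seq (S := 10) (T := 1) (ν := mem [r :: w, [], a2, r :: A,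
          [scale b r], [1], [], a7, a8, a9, a10, a11, a12, a13, a14, a15]) ?_
        (Runs.straight rfl rfl rfl))) key) (by simp only [List.length_cons]; omega)
    unfold scale
    by_cases h0 : r ≤ 0
    · rw [if_pos h0]
      exact Runs.mono (Runs.cond_pos (T := 1) (show r ≤ 0 from h0) (Runs.straight rfl rfl rfl))
        (by omega)
    · rw [if_neg h0]
      refine Runs.mono (Runs.cond_neg (T := 9) (show ¬ r ≤ 0 from h0) ?_) (by omega)
      by_cases h1 : r ≤ 1
      · rw [if_pos h1]
        exact Runs.mono (Runs.seq (S := 2) (T := 5)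
          (Runs.cond_pos (T := 1) (show r ≤ 1 from h1) (Runs.straight rfl rfl rfl))
          (Runs.straight rfl rfl rfl)) (by omega)
      · rw [if_neg h1]
        exact Runs.mono (Runs.seq (S := 2) (T := 5)
          (Runs.cond_neg (T := 1) (show ¬ r ≤ 1 from h1) (Runs.straight rfl rfl rfl))
          (Runs.straight rfl rfl rfl)) (by omega)

theorem runs_readUnary (n c : ℕ) (R a1 a2 a3 a4 a7 a8 a9 a10 a11 a13 a14 a15 : List ℝ) :
    Runs readUnary
      (mem [encList (List.replicate n []) ++ R, a1, a2, a3, a4, [1], [], a7, a8, a9, a10, a11,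
        [(c : ℝ)], a13, a14, a15])
      (mem [0 :: R, a1, a2, a3, a4, [1], [], List.replicate n 1 ++ a7, List.replicate n 1 ++ a8, a9,
        a10, a11, [((c + n : ℕ) : ℝ)], a13, a14, a15]) (20 * n + 1) := by
  induction n generalizing c a7 a8 with
  | zero => exact Runs.loop_done (show ¬ (1 : ℝ) ≤ 0 by norm_num)
  | succ n ih =>
    have key := ih (c + 1) (1 :: a7) (1 :: a8)
    have hrep : ∀ a : List ℝ, List.replicate (n + 1) 1 ++ a = List.replicate n 1 ++ 1 :: a := by
      intro a; simp [List.replicate_succ']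
    rw [hrep, hrep, show c + (n + 1) = c + 1 + n by ring]
    refine Runs.mono (Runs.loop_step (S := 13) (show (1 : ℝ) ≤ 1 from le_rfl) ?_ key) (by omega)
    rw [Nat.cast_add, Nat.cast_one]
    exact Runs.straight rfl rfl rfl

theorem runs_takeAnswer (n : ℕ) (w A : List ℝ)
    (a0 a1 a2 a4 a5 a7 a9 a10 a11 a12 a13 a14 a15 : List ℝ) :
    Runs takeAnswer
      (mem [a0, a1, a2, w, a4, a5, A, a7, List.replicate n 1, a9, a10, a11, a12, a13, a14, a15])
      (mem [a0, a1, a2, w.drop n, a4, a5, (List.ofFn (fun i : Fin n => w.getD i 0)).reverse ++ A,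
        a7, [], a9, a10, a11, a12, a13, a14, a15]) (8 * n + 1) := by
  induction n generalizing w A with
  | zero => exact Runs.loop_done (fun h : ([] : List ℝ) ≠ [] => h rfl)
  | succ n ih =>
    have key := ih w.tail (w.headD 0 :: A)
    have h1 : (List.ofFn (fun i : Fin (n + 1) => w.getD i 0)).reverse ++ A =
        (List.ofFn (fun i : Fin n => w.tail.getD i 0)).reverse ++ w.headD 0 :: A := by
      cases w <;> simp [List.ofFn_succ]
    have h2 : w.drop (n + 1) = w.tail.drop n := by cases w <;> simp
    rw [h1, h2, List.replicate_succ]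
    exact Runs.mono (Runs.loop_step (S := 5) (List.cons_ne_nil (1 : ℝ) (List.replicate n 1))
      (Runs.straight rfl rfl rfl) key) (by omega)

theorem runs_answer (n : ℕ) (w : List ℝ)
    (a0 a2 a4 a5 a7 a9 a10 a11 a12 a13 a14 a15 : List ℝ) :
    Runs answer
      (mem [a0, [], a2, w, a4, a5, [], a7, List.replicate n 1, a9, a10, a11, a12, a13, a14, a15])
      (mem [a0, List.ofFn (fun i : Fin n => w.getD i 0), a2, w.drop n, a4, a5, [],
        a7, [], a9, a10, a11, a12, a13, a14, a15]) (12 * n + 3) := by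
  have h := runs_takeAnswer n w [] a0 [] a2 a4 a5 a7 a9 a10 a11 a12 a13 a14 a15
  exact Runs.mono (h.seq (Runs.move_mem (by decide) rfl rfl rfl (by simp)))
    (by simp; omega)

theorem runs_query (G : List (Constraint.Applied 5)) (m n : ℕ) (ε B : ℝ) (L : List RawApplied)
    (hB : (encList (List.replicate n []) ++ encList (L.map RawApplied.enc)).foldl scale 1 = B)
    (hlow : ∀ k < m, (2 : ℝ) ^ k ≤ B * B + B * B) (hhigh : B * B + B * B < 2 ^ m) :
    Runs (query G)
      (mem [ε :: (encList (List.replicate n []) ++ encList (L.map RawApplied.enc)),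
        [], [], [], [], [], [], [], [], [], [], [], [], [], [], []])
      (mem [[0], [], [ε], [], [B * B + B * B], [1], [], [], List.replicate n 1,
        ε :: (encList (List.replicate (transform G m L n []).1 []) ++
          encList ((transform G m L n []).2.map RawApplied.enc)), [], [],
        [((transform G m L n []).1 : ℝ)], [], [], []])
      (50 * (encList (List.replicate n []) ++ encList (L.map RawApplied.enc)).length +
        L.length * (m * (2 * (symbolsList G).length + 10) + 201) + 20 * n +
        4 * (transform G m L n []).1 + 100) := by
  set W := encList (List.replicate n []) ++ encList (L.map RawApplied.enc) with hW
  set n' := (transform G m L n []).1 with hn'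
  have h2 := runs_scan W [] 1 [ε] [] [] [] [] [] [] [] [] []
  rw [hB, List.append_nil] at h2
  have h5 := runs_readUnary n 0 (encList (L.map RawApplied.enc)) [] [ε] [] [B * B + B * B] [] [] []
    [] [] [] [] []
  rw [← hW, List.append_nil, Nat.zero_add] at h5
  have h7 := runs_items G m (B * B + B * B) hlow hhigh L n [] [ε] (List.replicate n 1)
  -- The unary part is n' ones followed by a 0, so moving the n' ones of stack 7 onto that 0 writes
  -- it.
  have hun : encList (List.replicate n' []) = List.replicate n' (1 : ℝ) ++ [0] := by
    generalize n' = k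
    induction k with
    | zero => rfl
    | succ k ih => simp [List.replicate_succ, encList, ih]
  have hlen : (encList (L.map RawApplied.enc)).length ≤ W.length := by simp [hW]
  have h3 : Runs (.move 3 0)
      (mem [[], [], [ε], W.reverse, [B], [1], [], [], [], [], [], [], [], [], [], []])
      (mem [W, [], [ε], [], [B], [1], [], [], [], [], [], [], [], [], [], []])
      (4 * W.reverse.length + 1) :=
    Runs.move_mem (by decide) rfl rfl rfl (by simp)
  have h9 : Runs (.seq (.const 9 0) (.seq (.move 7 9) (.copy 2 9)))
      (mem [[0], [], [ε], [], [B * B + B * B], [1], [], List.replicate n' 1, List.replicate n 1,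
        encList ((transform G m L n []).2.map RawApplied.enc), [], [], [(n' : ℝ)], [], [], []])
      (mem [[0], [], [ε], [], [B * B + B * B], [1], [], [], List.replicate n 1,
        ε :: (encList (List.replicate n' []) ++
          encList ((transform G m L n []).2.map RawApplied.enc)), [], [],
        [(n' : ℝ)], [], [], []]) (4 * n' + 5) := by
    rw [hun, List.append_assoc]
    have hmove := Runs.move_mem (s := 7) (t := 9) (l := [[0], [], [ε], [], [B * B + B * B], [1], [],
      List.replicate n' 1, List.replicate n 1,
      0 :: encList ((transform G m L n []).2.map RawApplied.enc), [], [], [(n' : ℝ)], [], [], []])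
      (w := List.replicate n' 1) (l' := [[0], [], [ε], [], [B * B + B * B], [1], [], [],
      List.replicate n 1, List.replicate n' 1 ++
      0 :: encList ((transform G m L n []).2.map RawApplied.enc), [], [], [(n' : ℝ)], [], [], []])
      (by decide) rfl rfl rfl (by simp)
    exact Runs.mono (Runs.seq (S := 1) (Runs.straight rfl rfl rfl)
      (Runs.seq (T := 1) hmove (Runs.straight rfl rfl rfl)))
      (by simp only [List.length_replicate]; omega)
  have h4 : Runs (.block [.arith .mul 4 4 6, .pop 4, .arith .add 6 6 4, .pop 6, .const 12 0])
      (mem [W, [], [ε], [], [B], [1], [], [], [], [], [], [], [], [], [], []])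
      (mem [W, [], [ε], [], [B * B + B * B], [1], [], [], [], [], [], [], [((0 : ℕ) : ℝ)], [], [],
        []]) 9 := by
    rw [Nat.cast_zero]
    exact Runs.straight rfl rfl rfl
  have h1 : Runs (.block [.copy 0 2, .pop 0, .const 5 1, .const 4 1])
      (mem [ε :: W, [], [], [], [], [], [], [], [], [], [], [], [], [], [], []])
      (mem [W, [], [ε], [], [1], [1], [], [], [], [], [], [], [], [], [], []]) 7 :=
    Runs.straight rfl rfl rfl
  have h6 : Runs (.block [.pop 0, .const 9 0])
      (mem [0 :: encList (L.map RawApplied.enc), [], [ε], [], [B * B + B * B], [1], [],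
        List.replicate n 1, List.replicate n 1, [], [], [], [(n : ℝ)], [], [], []])
      (mem [encList (L.map RawApplied.enc), [], [ε], [], [B * B + B * B], [1], [],
        List.replicate n 1, List.replicate n 1, encList (([] : List RawApplied).map RawApplied.enc),
        [], [], [(n : ℝ)], [], [], []]) 3 :=
    Runs.straight rfl rfl rfl
  exact Runs.mono (h1.seq (h2.seq (h3.seq (h4.seq (h5.seq (h6.seq (h7.seq h9)))))))
    (by simp only [List.length_reverse]; omega)

end Reduction

namespace Constraint

/-! ### Binary constraints inside a constraint with imp support -/

/-- The substitution of two variables and of the two constants for the variables of a constraint. -/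
def substitute {k : ℕ} (s : Fin k → Fin 4) (b₀ b₁ : Bool) : Fin k → Bool :=
  fun i => ![b₀, b₁, false, true] (s i)

theorem IsAffine.of_equations {k : ℕ} {R : Set (Fin k → Bool)} {ι : Type*} [Fintype ι]
    (A : ι → Fin k → ZMod 2) (b : ι → ZMod 2)
    (h : ∀ x, x ∈ R ↔ ∀ t, A t ⬝ᵥ (fun i => if x i = true then 1 else 0) = b t) : IsAffine R := by
  refine ⟨Fintype.card ι, fun t => A ((Fintype.equivFin ι).symm t),
    fun t => b ((Fintype.equivFin ι).symm t), fun x => ?_⟩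
  rw [h, funext_iff]
  exact ⟨fun h t => h _, fun h t => by simpa [Matrix.mulVec] using h (Fintype.equivFin ι t)⟩

/-- Whether the variables `i` and `j` agree on the relation `R`. -/
def agree {k : ℕ} (R : Set (Fin k → Bool)) : Setoid (Fin k) where
  r i j := ∀ y ∈ R, y i = y j
  iseqv := ⟨fun _ _ _ => rfl, fun h y hy => (h y hy).symm, fun h h' y hy => (h y hy).trans (h' y hy)⟩

/-- A relation that is defined by fixing variables and identifying variables. -/
structure IsFixIdentify {k : ℕ} (R : Set (Fin k → Bool)) (l u : Fin k → Bool) : Prop where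
  low_mem : l ∈ R
  upp_mem : u ∈ R
  mem_iff : ∀ x, x ∈ R ↔ (∀ i, l i = true → x i = true) ∧ (∀ i, x i = true → u i = true) ∧
    ∀ i j, agree R i j → x i = x j

theorem IsFixIdentify.isAffine {k : ℕ} {R : Set (Fin k → Bool)} {l u : Fin k → Bool}
    (h : IsFixIdentify R l u) : IsAffine R := by
  classical
  -- The equations are x_i = 1 where l is 1, x_i = 0 where u is 0, and x_i - x_j = 0 for agreeing
  -- variables; indices failing the condition contribute 0 = 0.
  refine IsAffine.of_equations (ι := Fin k ⊕ (Fin k ⊕ Fin k × Fin k))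
    (Sum.elim (fun i => if l i = true then Pi.single i 1 else 0)
      (Sum.elim (fun i => if u i = true then 0 else Pi.single i 1)
        (fun p => if agree R p.1 p.2 then Pi.single p.1 1 - Pi.single p.2 1 else 0)))
    (Sum.elim (fun i => if l i = true then 1 else 0) (fun _ => 0)) (fun x => ?_)
  rw [h.mem_iff]
  simp only [Sum.forall, Sum.elim_inl, Sum.elim_inr, Prod.forall]
  refine and_congr (forall_congr' fun i => ?_) (and_congr (forall_congr' fun i => ?_)
    (forall_congr' fun i => forall_congr' fun j => ?_))
  · by_cases hi : l i = true <;> simp [hi]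
  · by_cases hi : u i = true <;> simp [hi]
  · by_cases hij : agree R i j
    · simp only [hij, if_true, sub_dotProduct, single_dotProduct, one_mul, forall_const]
      cases x i <;> cases x j <;> simp
    · simp [hij]

variable {f : Constraint}

/-- Imp relations contain the meet l and the join u of their elements. The hypothesis `hA`, applied
to the pattern l ≤ x ≤ u, shows that the complement of x in [l, u] also belongs to the support, and
this makes every implication between non-agreeing variables redundant. -/
theorem exists_isFixIdentify (hf : f.HasImpSupport) (hne : f.support.Nonempty)
    (hA : ∀ s : Fin f.arity → Fin 4, f.val (substitute s false false) ≠ 0 →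
      f.val (substitute s false true) ≠ 0 → f.val (substitute s true true) ≠ 0 →
      f.val (substitute s true false) ≠ 0) :
    ∃ l u, IsFixIdentify f.support l u := by
  classical
  obtain ⟨L, -, hL⟩ := hf
  obtain ⟨e, he⟩ := hne
  set l : Fin f.arity → Bool := fun i => decide (∀ x ∈ f.support, x i = true) with hl
  set u : Fin f.arity → Bool := fun i => decide (∃ x ∈ f.support, x i = true) with hu
  have hlR : l ∈ f.support := by
    rw [hL]
    intro a ha
    cases a with
    | delta0 i =>
      have h1 : e i = false := (hL e).1 he _ ha
      simp only [ImpAtom.Holds, hl, decide_eq_false_iff_not]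
      exact fun h => by simp [h e he] at h1
    | delta1 i =>
      simp only [ImpAtom.Holds, hl, decide_eq_true_eq]
      exact fun x hx => (hL x).1 hx _ ha
    | imp i j hij =>
      simp only [ImpAtom.Holds, hl, decide_eq_true_eq]
      exact fun h x hx => (hL x).1 hx _ ha (h x hx)
  have huR : u ∈ f.support := by
    rw [hL]
    intro a ha
    cases a with
    | delta0 i =>
      simp only [ImpAtom.Holds, hu, decide_eq_false_iff_not]
      rintro ⟨x, hx, hxi⟩
      have h1 : x i = false := (hL x).1 hx _ ha
      simp [h1] at hxi
    | delta1 i =>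
      simp only [ImpAtom.Holds, hu, decide_eq_true_eq]
      exact ⟨e, he, (hL e).1 he _ ha⟩
    | imp i j hij =>
      simp only [ImpAtom.Holds, hu, decide_eq_true_eq]
      rintro ⟨x, hx, hxi⟩
      exact ⟨x, hx, (hL x).1 hx _ ha hxi⟩
  have hlx : ∀ x ∈ f.support, ∀ i, l i = true → x i = true := by
    intro x hx i h
    simp only [hl, decide_eq_true_eq] at h
    exact h x hx
  have hxu : ∀ x ∈ f.support, ∀ i, x i = true → u i = true := by
    intro x hx i h
    simp only [hu, decide_eq_true_eq]
    exact ⟨x, hx, h⟩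
  have hcomp : ∀ x ∈ f.support, (fun i => if x i = true then l i else u i) ∈ f.support := by
    intro x hx
    -- A variable goes to the constant 1 if it is on in l, to the second free variable if it is on
    -- in x but not in l, to the first if it is on in u but not in x, and to 0 otherwise. The
    -- patterns 00, 01, 11 are then l, x, u, and 10 is the complement of x.
    set s : Fin f.arity → Fin 4 := fun i =>
      if l i = true then 3 else if x i = true then 1 else if u i = true then 0 else 2 with hs
    have key : ∀ i, substitute s false false i = l i ∧ substitute s false true i = x i ∧
        substitute s true true i = u i ∧
        substitute s true false i = if x i = true then l i else u i := by
      intro i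
      have h1 := hlx x hx i
      have h2 := hxu x hx i
      simp only [substitute, hs]
      cases h : l i <;> cases h' : x i <;> cases h'' : u i <;> simp_all
    have h00 : substitute s false false = l := funext fun i => (key i).1
    have h01 : substitute s false true = x := funext fun i => (key i).2.1
    have h11 : substitute s true true = u := funext fun i => (key i).2.2.1
    have h10 : substitute s true false = fun i => if x i = true then l i else u i :=
      funext fun i => (key i).2.2.2
    have := hA s (h00 ▸ hlR) (h01 ▸ hx) (h11 ▸ huR)
    rwa [h10] at this
  refine ⟨l, u, hlR, huR, fun x => ⟨fun hx => ⟨hlx x hx, hxu x hx, fun i j h => h x hx⟩, ?_⟩⟩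
  rintro ⟨h1, h2, h3⟩
  rw [hL]
  intro a ha
  cases a with
  | delta0 i =>
    have hui : u i = false := (hL u).1 huR _ ha
    have := h2 i
    simp only [ImpAtom.Holds]
    simpa [hui] using this
  | delta1 i => exact h1 i ((hL l).1 hlR _ ha)
  | imp i j hij =>
    intro hxi
    -- If i and j do not agree, some y in the support has y_i = 0 and y_j = 1. Its complement takes
    -- the values u_i and l_j there, so the atom yields u_i → l_j, and x_i → u_i → l_j → x_j.
    by_cases hag : agree f.support i j
    · rw [← h3 i j hag, hxi]
    · have : ∃ y ∈ f.support, y i ≠ y j := by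
        by_contra hcon
        push Not at hcon
        exact hag hcon
      obtain ⟨y, hy, hyij⟩ := this
      have himp : y i = true → y j = true := (hL y).1 hy _ ha
      have hyi : y i = false := by
        cases h : y i with
        | false => rfl
        | true => exact absurd (h.trans (himp h).symm) hyij
      have hyj : y j = true := by
        cases h : y j with
        | true => rfl
        | false => exact absurd (hyi.trans h.symm) hyij
      have hc : (if y i = true then l i else u i) = true →
          (if y j = true then l j else u j) = true := (hL _).1 (hcomp y hy) _ ha
      simp only [hyi, hyj, if_true] at hc
      exact h1 j (hc (by simpa using h2 i hxi))

/-- The support consists of l joined with arbitrary unions of the free classes of agreeing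
variables. By `hmod`, adding one class multiplies the value by a factor that does not depend on the
classes already present. Hence `f` is `f l` times one weight per class, cut down to the support by
unary zeros and EQ; XOR is not needed. -/
theorem IsFixIdentify.mem_ED {l u : Fin f.arity → Bool} (h : IsFixIdentify f.support l u)
    (i₀ : Fin f.arity)
    (hmod : ∀ s : Fin f.arity → Fin 4, f.val (substitute s false false) ≠ 0 →
      f.val (substitute s false true) ≠ 0 → f.val (substitute s true false) ≠ 0 →
      f.val (substitute s true true) ≠ 0 →
      f.val (substitute s false false) * f.val (substitute s true true) =
        f.val (substitute s false true) * f.val (substitute s true false)) : f ∈ ED := by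
  classical
  let S := agree f.support
  let r : Fin f.arity → Fin f.arity := fun j => (Quotient.mk S j).out
  have hr : ∀ j, S (r j) j := fun j => Quotient.mk_out j
  have hr' : ∀ i j, S i j → r i = r j := fun i j hij => congrArg Quotient.out (Quotient.sound hij)
  -- the join of `l` and of the classes of the elements of `T`
  let y : Finset (Fin f.arity) → Fin f.arity → Bool :=
    fun T j => decide (l j = true ∨ ∃ i ∈ T, S i j)
  let reps : Finset (Fin f.arity) := Finset.univ.filter (fun i => r i = i ∧ u i = true ∧ l i = false)
  have hy : ∀ T ⊆ reps, y T ∈ f.support := by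
    intro T hT
    rw [h.mem_iff]
    refine ⟨fun i hi => by simp [y, hi], fun i hi => ?_, fun i j hij => ?_⟩
    · simp only [y, decide_eq_true_eq] at hi
      obtain hi | ⟨a, ha, hai⟩ := hi
      · exact ((h.mem_iff u).1 h.upp_mem).1 i hi
      · rw [← hai u h.upp_mem]
        exact (Finset.mem_filter.1 (hT ha)).2.2.1
    · simp only [y, decide_eq_decide]
      rw [hij l h.low_mem]
      exact or_congr Iff.rfl ⟨fun ⟨a, ha, hai⟩ => ⟨a, ha, S.trans hai hij⟩,
        fun ⟨a, ha, haj⟩ => ⟨a, ha, S.trans haj (S.symm hij)⟩⟩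
  let w : Fin f.arity → ℝ≥0 := fun i => f.val (y {i}) / f.val l
  have hl0 : f.val l ≠ 0 := h.low_mem
  have hprod : ∀ T ⊆ reps, f.val (y T) = f.val l * ∏ i ∈ T, w i := by
    intro T
    induction T using Finset.induction_on with
    | empty =>
      intro _
      have : y ∅ = l := by funext j; simp [y]
      simp [this]
    | insert a T haT ih =>
      intro hT
      have hT' : T ⊆ reps := (Finset.subset_insert a T).trans hT
      have ha : a ∈ reps := hT (Finset.mem_insert_self a T)
      have hla : l a = false := (Finset.mem_filter.1 ha).2.2.2
      have hdisj : ∀ j, S a j → ¬ ∃ i ∈ T, S i j := by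
        rintro j haj ⟨i, hi, hij⟩
        have h1 : r i = r a := hr' _ _ (S.trans hij (S.symm haj))
        rw [(Finset.mem_filter.1 (hT' hi)).2.1, (Finset.mem_filter.1 ha).2.1] at h1
        exact haT (h1 ▸ hi)
      have hlS : ∀ j, S a j → l j = false := fun j haj => by rw [← haj l h.low_mem, hla]
      -- The new class of a goes to the first variable and the classes of T to the second. The
      -- patterns 00, 01, 10, 11 become l, `y T`, `y {a}`, `y (insert a T)`.
      let s : Fin f.arity → Fin 4 := fun j =>
        if l j = true then 3 else if S a j then 0 else if ∃ i ∈ T, S i j then 1 else 2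
      have key : ∀ j, substitute s false false j = l j ∧ substitute s false true j = y T j ∧
          substitute s true false j = y {a} j ∧ substitute s true true j = y (insert a T) j := by
        intro j
        have h1 := hdisj j
        have h2 := hlS j
        simp only [substitute, s, y, Finset.mem_singleton, exists_eq_left, Finset.mem_insert,
          exists_eq_or_imp]
        by_cases hlj : l j = true
        · simp [hlj]
        · by_cases haj : S a j
          · simp [hlj, haj, h1 haj]
          · by_cases hij : ∃ i ∈ T, S i j
            · simp [hlj, haj, hij]
            · simp [hlj, haj, hij]
      have h00 : substitute s false false = l := funext fun i => (key i).1
      have h01 : substitute s false true = y T := funext fun i => (key i).2.1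
      have h10 : substitute s true false = y {a} := funext fun i => (key i).2.2.1
      have h11 : substitute s true true = y (insert a T) := funext fun i => (key i).2.2.2
      have hm := hmod s
      rw [h00, h01, h10, h11] at hm
      have := hm hl0 (hy T hT') (hy {a} (by simpa using ha)) (hy _ hT)
      rw [ih hT'] at this
      rw [Finset.prod_insert haT]
      apply mul_left_cancel₀ hl0
      rw [this]
      have hw : f.val (y {a}) = f.val l * w a := by
        simp only [w]; field_simp
      rw [hw]; ring
  -- The zeros enforce l and u. The weight sits only on the representative, so that each class is
  -- counted once.
  let v : Fin f.arity → Bool → ℝ≥0 := fun i b =>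
    if (b = false ∧ l i = true) ∨ (b = true ∧ u i = false) then 0
    else if b = true ∧ i ∈ reps then w i else 1
  let E : Finset (Fin f.arity × Fin f.arity) := Finset.univ.filter (fun p => S p.1 p.2)
  let H₁ : List (Applied f.arity) := List.ofFn (fun i => ⟨⟨1, fun x => v i (x 0)⟩, fun _ => i⟩)
  let H₂ : List (Applied f.arity) := E.toList.map (fun p => ⟨eq, ![p.1, p.2]⟩)
  have hH₁ : ∀ x, prodEval H₁ x = ∏ i, v i (x i) := by
    intro x
    simp only [prodEval, H₁, List.map_ofFn, List.prod_ofFn, Function.comp_def, Applied.eval]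
  have heq : ∀ (p : Fin f.arity × Fin f.arity) (x : Fin f.arity → Bool),
      (⟨eq, ![p.1, p.2]⟩ : Applied f.arity).eval x = if x p.1 = x p.2 then 1 else 0 := by
    intro p x
    rfl
  -- The scalar `f.val l` has to be carried by some unary constraint; any variable `i₀` will do.
  refine ⟨⟨⟨1, fun _ => f.val l⟩, fun _ => i₀⟩ :: (H₁ ++ H₂), ?_, fun x => ?_⟩
  · intro a ha
    simp only [List.mem_cons, List.mem_append, H₁, H₂, List.mem_ofFn', Set.mem_range,
      List.mem_map] at ha
    obtain rfl | ⟨i, rfl⟩ | ⟨p, -, rfl⟩ := ha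
    · exact Or.inl rfl
    · exact Or.inl rfl
    · exact Or.inr (Or.inl rfl)
  · have hsplit : prodEval (⟨⟨1, fun _ => f.val l⟩, fun _ => i₀⟩ :: (H₁ ++ H₂)) x =
        f.val l * ((∏ i, v i (x i)) * prodEval H₂ x) := by
      rw [← hH₁]
      simp only [prodEval, List.map_cons, List.prod_cons, List.map_append, List.prod_append]
      rfl
    rw [hsplit]
    by_cases hx : x ∈ f.support
    · obtain ⟨h1, h2, h3⟩ := (h.mem_iff x).1 hx
      have hH₂ : prodEval H₂ x = 1 := by
        refine List.prod_eq_one fun q hq => ?_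
        simp only [H₂, List.map_map, List.mem_map, Finset.mem_toList] at hq
        obtain ⟨p, hp, rfl⟩ := hq
        rw [Function.comp_apply, heq, if_pos (h3 _ _ (Finset.mem_filter.1 hp).2)]
      have hv : ∀ i, v i (x i) = if x i = true ∧ i ∈ reps then w i else 1 := by
        intro i
        simp only [v]
        rw [if_neg]
        rintro (⟨ha, hb⟩ | ⟨ha, hb⟩)
        · simp [h1 i hb] at ha
        · simp [h2 i ha] at hb
      have hxy : x = y (reps.filter (fun i => x i = true)) := by
        funext j
        rw [Bool.eq_iff_iff]
        simp only [y, decide_eq_true_eq, Finset.mem_filter, reps, Finset.mem_univ, true_and]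
        constructor
        · intro hj
          by_cases hlj : l j = true
          · exact Or.inl hlj
          · have hrj := hr j
            refine Or.inr ⟨r j, ⟨⟨hr' _ _ hrj, ?_, ?_⟩, ?_⟩, hrj⟩
            · rw [hrj u h.upp_mem]; exact h2 j hj
            · rw [hrj l h.low_mem]; simpa using hlj
            · rw [hrj x hx]; exact hj
        · rintro (hj | ⟨i, ⟨-, hi⟩, hij⟩)
          · exact h1 j hj
          · rw [← hij x hx]; exact hi
      have hfx := hprod _ (Finset.filter_subset (fun i => x i = true) reps)
      rw [← hxy] at hfx
      rw [hfx, hH₂, mul_one]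
      congr 1
      simp only [hv, Finset.prod_ite, Finset.prod_const_one, mul_one]
      refine Finset.prod_congr ?_ fun _ _ => rfl
      ext i
      simp [and_comm]
    · have hfx : f.val x = 0 := by simpa [support] using hx
      rw [hfx]
      rw [h.mem_iff] at hx
      by_cases h1 : ∀ i, v i (x i) ≠ 0
      · have : ∃ i j, S i j ∧ x i ≠ x j := by
          by_contra hcon
          push Not at hcon
          refine hx ⟨fun i hi => ?_, fun i hi => ?_, hcon⟩
          · by_contra hxi
            exact h1 i (by simp [v, hi, hxi])
          · by_contra hui
            exact h1 i (by simp [v, hi, hui])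
        obtain ⟨i, j, hij, hne⟩ := this
        have hz : prodEval H₂ x = 0 := by
          refine List.prod_eq_zero ?_
          simp only [H₂, List.map_map, List.mem_map, Finset.mem_toList]
          exact ⟨(i, j), by simpa [E] using hij, by rw [Function.comp_apply, heq, if_neg hne]⟩
        rw [hz, mul_zero, mul_zero]
      · push Not at h1
        obtain ⟨i, hi⟩ := h1
        rw [Finset.prod_eq_zero (Finset.mem_univ i) hi, zero_mul, mul_zero]

/-- A constraint with imp support that does not have affine support or is not in `ED` yields, by
identifying variables and by substituting constants, a binary constraint `(a, b, c, d)` with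
`a, b, d ≠ 0` and `bc < ad`, or with `a, b, c, d ≠ 0` and `ad < bc`. -/
theorem exists_binary (hf : f.HasImpSupport) (h : ¬ f.HasAffineSupport ∨ f ∉ ED) :
    ∃ s : Fin f.arity → Fin 4,
      (f.val (substitute s false false) ≠ 0 ∧ f.val (substitute s false true) ≠ 0 ∧
        f.val (substitute s true true) ≠ 0 ∧
        f.val (substitute s false true) * f.val (substitute s true false) <
          f.val (substitute s false false) * f.val (substitute s true true)) ∨
      (f.val (substitute s false false) ≠ 0 ∧ f.val (substitute s false true) ≠ 0 ∧
        f.val (substitute s true false) ≠ 0 ∧ f.val (substitute s true true) ≠ 0 ∧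
        f.val (substitute s false false) * f.val (substitute s true true) <
          f.val (substitute s false true) * f.val (substitute s true false)) := by
  by_contra hcon
  push Not at hcon
  -- A conjunction of a positive number of atoms mentions at least one variable.
  obtain ⟨i₀⟩ : Nonempty (Fin f.arity) := by
    obtain ⟨L, hL, -⟩ := hf
    cases L with
    | nil => exact absurd rfl hL
    | cons a L =>
      cases a with
      | delta0 i | delta1 i => exact ⟨i⟩
      | imp i j _ => exact ⟨i⟩
  by_cases hne : f.support.Nonempty
  -- With c = 0 the inequality ad ≤ bc would give ad = 0. Below, the two inequalities together give
  -- ad = bc.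
  · obtain ⟨l, u, hlu⟩ := exists_isFixIdentify hf hne (fun s h00 h01 h11 h10 => by
      have := (hcon s).1 h00 h01 h11
      rw [h10, mul_zero] at this
      exact mul_ne_zero h00 h11 (le_antisymm this zero_le))
    refine h.elim (fun h => h hlu.isAffine) (fun h => h (hlu.mem_ED i₀ fun s h00 h01 h10 h11 =>
      le_antisymm ((hcon s).1 h00 h01 h11) ((hcon s).2 h00 h01 h10 h11)))
  · rw [Set.not_nonempty_iff_eq_empty] at hne
    refine h.elim (fun h => h ?_) (fun h => h ?_)
    -- The empty relation is the solution set of the single equation 0 = 1.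
    · refine IsAffine.of_equations (ι := Unit) 0 1 fun x => ?_
      simp [hne]
    · refine ⟨[⟨⟨1, fun _ => 0⟩, fun _ => i₀⟩], ?_, fun x => ?_⟩
      · intro a ha
        rw [List.mem_singleton] at ha
        subst ha
        exact Or.inl rfl
      · have : x ∉ f.support := by simp [hne]
        simpa [support, prodEval, Applied.eval] using this

end Constraint

namespace Constraint

/-! ### A gadget for `Implies` -/

/-- A conjunction of constraints from `{f} ∪ 𝒰` on the variables `x, y, z₀, z₁, z₂` that
approximates `Implies(x, y)`. -/
structure IsGadget (f : Constraint) (G : List (Applied 5)) : Prop where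
  mem : ∀ a ∈ G, a.con ∈ {f} ∪ unary
  le_one : ∀ x, prodEval G x ≤ 1
  le_half : ∀ x, x 0 = true → x 1 = false → prodEval G x ≤ 1 / 2
  eq_one : ∀ b₀ b₁ : Bool, (b₀ = true → b₁ = true) →
    ∃ z₀ z₁ z₂, prodEval G ![b₀, b₁, z₀, z₁, z₂] = 1

theorem prodEval_append {n : ℕ} (H H' : List (Applied n)) (x : Fin n → Bool) :
    prodEval (H ++ H') x = prodEval H x * prodEval H' x := by
  simp [prodEval]

theorem prodEval_replicate {n : ℕ} (H : List (Applied n)) (m : ℕ) (x : Fin n → Bool) :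
    prodEval (List.replicate m H).flatten x = prodEval H x ^ m := by
  induction m with
  | zero => simp [prodEval]
  | succ m ih => rw [List.replicate_succ, List.flatten_cons, prodEval_append, ih, pow_succ']

/-- The constraints that force `z₀ = 0` and `z₁ = 1`. -/
def pins : List (Applied 5) :=
  [⟨⟨1, fun x => if x 0 = true then 0 else 1⟩, fun _ => 2⟩,
    ⟨⟨1, fun x => if x 0 = true then 1 else 0⟩, fun _ => 3⟩]

theorem prodEval_pins (x : Fin 5 → Bool) :
    prodEval pins x = if x 2 = false ∧ x 3 = true then 1 else 0 := by
  simp only [prodEval, pins, List.map_cons, List.map_nil, Applied.eval, List.prod_cons,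
    List.prod_nil]
  by_cases h2 : x 2 = true <;> by_cases h3 : x 3 = true <;> simp [h2, h3]

/-- The binary constraint that arises from `f` by the substitution `s`, applied to the variables
`p` and `q` and multiplied by unary constraints. -/
def scaledBinary (f : Constraint) (s : Fin f.arity → Fin 4) (α β : Bool → ℝ≥0) (p q : Fin 5) :
    List (Applied 5) :=
  [⟨f, fun i => ![p, q, 2, 3] (s i)⟩, ⟨⟨1, fun x => α (x 0)⟩, fun _ => p⟩,
    ⟨⟨1, fun x => β (x 0)⟩, fun _ => q⟩]

variable {f : Constraint}

theorem scaledBinary_mem {s : Fin f.arity → Fin 4} {α β : Bool → ℝ≥0} {p q : Fin 5}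
    {a : Applied 5} (ha : a ∈ scaledBinary f s α β p q) : a.con ∈ {f} ∪ unary := by
  simp only [scaledBinary, List.mem_cons, List.not_mem_nil, or_false] at ha
  obtain rfl | rfl | rfl := ha
  exacts [Or.inl rfl, Or.inr rfl, Or.inr rfl]

theorem pins_mem {a : Applied 5} (ha : a ∈ pins) : a.con ∈ {f} ∪ unary := by
  simp only [pins, List.mem_cons, List.not_mem_nil, or_false] at ha
  obtain rfl | rfl := ha
  exacts [Or.inr rfl, Or.inr rfl]

theorem prodEval_scaledBinary (s : Fin f.arity → Fin 4) (α β : Bool → ℝ≥0) (p q : Fin 5)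
    {x : Fin 5 → Bool} (h2 : x 2 = false) (h3 : x 3 = true) :
    prodEval (scaledBinary f s α β p q) x =
      f.val (substitute s (x p) (x q)) * (α (x p) * β (x q)) := by
  have h : (fun i => x (![p, q, 2, 3] (s i))) = substitute s (x p) (x q) := by
    funext i
    simp only [substitute]
    generalize s i = t
    fin_cases t <;> simp [h2, h3]
  simp only [prodEval, scaledBinary, List.map_cons, List.map_nil, Applied.eval, List.prod_cons,
    List.prod_nil, mul_one, h]

/-- The weights of a gadget may be raised to a power. -/
theorem exists_gadget_of_lt_one {G : List (Applied 5)} {δ : ℝ≥0} (hδ : δ < 1)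
    (hmem : ∀ a ∈ G, a.con ∈ {f} ∪ unary) (hle : ∀ x, prodEval G x ≤ 1)
    (hlt : ∀ x, x 0 = true → x 1 = false → prodEval G x ≤ δ)
    (heq : ∀ b₀ b₁ : Bool, (b₀ = true → b₁ = true) →
      ∃ z₀ z₁ z₂, prodEval G ![b₀, b₁, z₀, z₁, z₂] = 1) : ∃ G', IsGadget f G' := by
  obtain ⟨K, hK⟩ := exists_pow_lt_of_lt_one (show (0 : ℝ≥0) < 1 / 2 by positivity) hδ
  refine ⟨(List.replicate K G).flatten, ⟨?_, ?_, ?_, ?_⟩⟩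
  · intro a ha
    obtain ⟨l, hl, hal⟩ := List.mem_flatten.1 ha
    exact hmem a ((List.mem_replicate.1 hl).2 ▸ hal)
  · intro x
    rw [prodEval_replicate]
    exact pow_le_one₀ zero_le (hle x)
  · intro x h0 h1
    rw [prodEval_replicate]
    exact (pow_le_pow_left₀ zero_le (hlt x h0 h1) K).trans hK.le
  · intro b₀ b₁ hb
    obtain ⟨z₀, z₁, z₂, hz⟩ := heq b₀ b₁ hb
    exact ⟨z₀, z₁, z₂, by rw [prodEval_replicate, hz, one_pow]⟩

/-- A gadget whose first constraints are `pins` need only be checked for `z₀ = 0` and `z₁ = 1`. -/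
theorem exists_gadget_of_pins {G : List (Applied 5)} {δ : ℝ≥0} (hδ : δ < 1)
    (hmem : ∀ a ∈ G, a.con ∈ {f} ∪ unary)
    (hle : ∀ x, x 2 = false → x 3 = true → prodEval G x ≤ 1)
    (hlt : ∀ x, x 2 = false → x 3 = true → x 0 = true → x 1 = false → prodEval G x ≤ δ)
    (heq : ∀ b₀ b₁ : Bool, (b₀ = true → b₁ = true) →
      ∃ z, prodEval G ![b₀, b₁, false, true, z] = 1) : ∃ G', IsGadget f G' := by
  have hval : ∀ x, prodEval (pins ++ G) x =
      if x 2 = false ∧ x 3 = true then prodEval G x else 0 := by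
    intro x
    rw [prodEval_append, prodEval_pins, ite_mul, one_mul, zero_mul]
  refine exists_gadget_of_lt_one (G := pins ++ G) hδ ?_ ?_ ?_ ?_
  · intro a ha
    exact (List.mem_append.1 ha).elim pins_mem (hmem a)
  · intro x
    rw [hval]
    split_ifs with h
    · exact hle x h.1 h.2
    · exact zero_le
  · intro x h0 h1
    rw [hval]
    split_ifs with h
    · exact hlt x h.1 h.2 h0 h1
    · exact zero_le
  · intro b₀ b₁ hb
    obtain ⟨z, hz⟩ := heq b₀ b₁ hb
    exact ⟨false, true, z, by rw [hval, if_pos ⟨rfl, rfl⟩, hz]⟩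

/-- Multiplying the rows and columns of a 2 × 2 table by positive weights preserves only the ratio
ad : bc, so three entries can be made 1 and the fourth becomes that ratio or its inverse. If bc <
ad, the small entry is put at 10. If ad < bc, it can be put at 00 or at 11. -/
theorem exists_gadget (hf : f.HasImpSupport) (h : ¬ f.HasAffineSupport ∨ f ∉ ED) :
    ∃ G, IsGadget f G := by
  obtain ⟨s, ⟨h00, h01, h11, hlt⟩ | ⟨h00, h01, h10, h11, hlt⟩⟩ := exists_binary hf h
  · set a := f.val (substitute s false false) with ha
    set b := f.val (substitute s false true) with hb
    set c := f.val (substitute s true false) with hc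
    set d := f.val (substitute s true true) with hd
    have hδ : b * c / (a * d) < 1 := (div_lt_one (by positivity)).2 hlt
    -- The weights are chosen so that the entries at 00, 01 and 11 become 1.
    let α : Bool → ℝ≥0 := fun t => if t = true then b / d else 1
    let β : Bool → ℝ≥0 := fun t => if t = true then 1 / b else 1 / a
    have hval : ∀ x : Fin 5 → Bool, x 2 = false → x 3 = true →
        prodEval (scaledBinary f s α β 0 1) x =
          if x 0 = true ∧ x 1 = false then b * c / (a * d) else 1 := by
      intro x h2 h3
      rw [prodEval_scaledBinary s α β 0 1 h2 h3]
      cases x 0 <;> cases x 1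
      · simp only [α, β, ← ha]; simp [h00]
      · simp only [α, β, ← hb]; simp [h01]
      · simp only [α, β, ← hc]; simp; field_simp
      · simp only [α, β, ← hd]; simp; field_simp
    refine exists_gadget_of_pins (G := scaledBinary f s α β 0 1) hδ
      (fun a ha => scaledBinary_mem ha) (fun x h2 h3 => ?_)
      (fun x h2 h3 h0 h1 => ?_) (fun b₀ b₁ hb => ⟨false, ?_⟩)
    · rw [hval x h2 h3]
      split_ifs
      exacts [hδ.le, le_rfl]
    · rw [hval x h2 h3, if_pos ⟨h0, h1⟩]
    · rw [hval _ rfl rfl, if_neg]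
      rintro ⟨h0, h1⟩
      have h0' : b₀ = true := h0
      have h1' : b₁ = false := h1
      simp [hb h0'] at h1'
  · set a := f.val (substitute s false false) with ha
    set b := f.val (substitute s false true) with hb
    set c := f.val (substitute s true false) with hc
    set d := f.val (substitute s true true) with hd
    have hδ : a * d / (b * c) < 1 := (div_lt_one (by positivity)).2 hlt
    -- The weights α, β leave the small entry at 00 (soft OR); α', β' leave it at 11 (soft NAND).
    let α : Bool → ℝ≥0 := fun t => if t = true then b / d else 1
    let β : Bool → ℝ≥0 := fun t => if t = true then 1 / b else d / (b * c)
    let α' : Bool → ℝ≥0 := fun t => if t = true then a / c else 1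
    let β' : Bool → ℝ≥0 := fun t => if t = true then 1 / b else 1 / a
    have hor : ∀ (p q : Fin 5) (x : Fin 5 → Bool), x 2 = false → x 3 = true →
        prodEval (scaledBinary f s α β p q) x =
          if x p = false ∧ x q = false then a * d / (b * c) else 1 := by
      intro p q x h2 h3
      rw [prodEval_scaledBinary s α β p q h2 h3]
      cases x p <;> cases x q
      · simp only [α, β, ← ha]; simp; field_simp
      · simp only [α, β, ← hb]; simp [h01]
      · simp only [α, β, ← hc]; simp; field_simp
      · simp only [α, β, ← hd]; simp; field_simp
    have hnand : ∀ (p q : Fin 5) (x : Fin 5 → Bool), x 2 = false → x 3 = true →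
        prodEval (scaledBinary f s α' β' p q) x =
          if x p = true ∧ x q = true then a * d / (b * c) else 1 := by
      intro p q x h2 h3
      rw [prodEval_scaledBinary s α' β' p q h2 h3]
      cases x p <;> cases x q
      · simp only [α', β', ← ha]; simp [h00]
      · simp only [α', β', ← hb]; simp [h01]
      · simp only [α', β', ← hc]; simp; field_simp
      · simp only [α', β', ← hd]; simp; field_simp
    -- With z the last variable, these are OR(x, z), NAND(x, z) and OR(z, y). For x = 1, y = 0,
    -- either value of z violates one of them; otherwise z = ¬x satisfies all three.
    have hval : ∀ x : Fin 5 → Bool, x 2 = false → x 3 = true →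
        prodEval (scaledBinary f s α β 0 4 ++ (scaledBinary f s α' β' 0 4 ++
          scaledBinary f s α β 4 1)) x =
          (if x 0 = false ∧ x 4 = false then a * d / (b * c) else 1) *
          ((if x 0 = true ∧ x 4 = true then a * d / (b * c) else 1) *
            if x 4 = false ∧ x 1 = false then a * d / (b * c) else 1) := by
      intro x h2 h3
      rw [prodEval_append, prodEval_append, hor 0 4 x h2 h3, hnand 0 4 x h2 h3, hor 4 1 x h2 h3]
    refine exists_gadget_of_pins (G := scaledBinary f s α β 0 4 ++ (scaledBinary f s α' β' 0 4 ++
      scaledBinary f s α β 4 1)) hδ ?_ (fun x h2 h3 => ?_) (fun x h2 h3 h0 h1 => ?_)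
      (fun b₀ b₁ hb => ⟨!b₀, ?_⟩)
    · intro a ha
      rw [List.mem_append, List.mem_append] at ha
      obtain ha | ha | ha := ha <;> exact scaledBinary_mem ha
    · rw [hval x h2 h3]
      refine mul_le_one' ?_ (mul_le_one' ?_ ?_) <;> split_ifs <;> first | exact hδ.le | exact le_rfl
    · rw [hval x h2 h3, h0, h1]
      cases x 4 <;> simp
    · rw [hval _ rfl rfl]
      change (if b₀ = false ∧ (!b₀) = false then _ else 1) *
        ((if b₀ = true ∧ (!b₀) = true then _ else 1) *
          if (!b₀) = false ∧ b₁ = false then _ else 1) = (1 : ℝ≥0)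
      cases b₀ <;> cases b₁ <;> simp_all

end Constraint

/-! ### Programs with a single oracle call -/

theorem Runs.run_eq {c : Prog} {μ ν : Memory} {T : ℕ} (h : Runs c μ ν T) (M : Oracle) :
    Config.run M T ⟨[c], μ⟩ = PMF.pure ⟨[], ν⟩ := by
  obtain ⟨t, ht, h⟩ := h
  obtain ⟨s, rfl⟩ := Nat.exists_eq_add_of_le ht
  rw [(h.reach M []).run_add, Config.run_halted]

theorem Runs.not_calls {c : Prog} {μ ν : Memory} {T : ℕ} (h : Runs c μ ν T) (M : Oracle) (t : ℕ)
    {C : Config} (hC : C ∈ (Config.run M t ⟨[c], μ⟩).support) (w : List ℝ) : ¬ C.Calls w := by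
  obtain ⟨s, -, h⟩ := h
  rcases lt_or_ge t s with hts | hts
  · exact (h.reach M []).not_calls hts hC w
  · obtain ⟨r, rfl⟩ := Nat.exists_eq_add_of_le hts
    rw [(h.reach M []).run_add, Config.run_halted, PMF.support_pure, Set.mem_singleton_iff] at hC
    rintro ⟨q, a, k, hk, -⟩
    simp [hC] at hk

/-- A computation with a single oracle call. -/
theorem run_single_call {c d : Prog} {q a : ℕ} {μ ν : Memory} {ξ : List ℝ → Memory} {T₁ T₂ : ℕ}
    (h₁ : Runs c μ ν T₁)
    (h₂ : ∀ w, Runs d (Function.update (Function.update ν q []) a w) (ξ w) T₂) (M : Oracle) :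
    (∀ t, ∀ C ∈ (Config.run M t ⟨[.seq c (.seq (.call q a) d)], μ⟩).support,
      ∀ w, C.Calls w → w = ν q) ∧
    ∃ T ≤ T₁ + T₂ + 3, Config.run M T ⟨[.seq c (.seq (.call q a) d)], μ⟩ =
      (M (ν q)).map (fun w => ⟨[], ξ w⟩) := by
  obtain ⟨t₁, ht₁, h₁⟩ := h₁
  have hreach : Reach M (t₁ + 1 + 1) ⟨[.seq c (.seq (.call q a) d)], μ⟩ ⟨[.call q a, d], ν⟩ := by
    refine Reach.step (by rintro w ⟨q, a, k, h, -⟩; simp at h) (by simp only [Config.step]; rfl)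
      ((h₁.reach M _).trans (Reach.step (t := 0) (by rintro w ⟨q, a, k, h, -⟩; simp at h)
        (by simp only [Config.step]) (Reach.refl _)))
  have hcall : ∀ s, Config.run M (s + 1) ⟨[.call q a, d], ν⟩ = (M (ν q)).bind
      (fun w => Config.run M s ⟨[d], Function.update (Function.update ν q []) a w⟩) := by
    intro s
    rw [Config.run, Config.step, PMF.bind_map]
    rfl
  constructor
  · intro t C hC w hw
    rcases lt_or_ge t (t₁ + 1 + 1) with ht | ht
    · exact absurd hw (hreach.not_calls ht hC w)
    · obtain ⟨s, rfl⟩ := Nat.exists_eq_add_of_le ht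
      rw [hreach.run_add] at hC
      cases s with
      | zero =>
        rw [Config.run, PMF.support_pure, Set.mem_singleton_iff] at hC
        subst hC
        obtain ⟨q', a', k, h, hw⟩ := hw
        simp only [List.cons.injEq, Prog.call.injEq] at h
        rw [← hw, ← h.1.1]
      | succ s =>
        rw [hcall, PMF.mem_support_bind_iff] at hC
        obtain ⟨v, -, hC⟩ := hC
        exact absurd hw ((h₂ v).not_calls M s hC w)
  -- Two steps unfold the nested `seq`, and one step is the call.
  · refine ⟨t₁ + 1 + 1 + (T₂ + 1), by omega, ?_⟩
    rw [hreach.run_add, hcall]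
    simp_rw [(h₂ _).run_eq M]
    rfl

/-! ### Correctness of the reduction -/

namespace Reduction

open Constraint

/-- The value of an applied constraint at an assignment of all variables. -/
noncomputable def rawEval (τ : ℕ → Bool) (a : RawApplied) : ℝ≥0 :=
  a.con.val (fun k => τ (a.scope k))

noncomputable def prodRaw (L : List RawApplied) (τ : ℕ → Bool) : ℝ≥0 := (L.map (rawEval τ)).prod

theorem prodRaw_cons (a : RawApplied) (L : List RawApplied) (τ : ℕ → Bool) :
    prodRaw (a :: L) τ = rawEval τ a * prodRaw L τ := by simp [prodRaw]

theorem prodRaw_append (L L' : List RawApplied) (τ : ℕ → Bool) :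
    prodRaw (L ++ L') τ = prodRaw L τ * prodRaw L' τ := by simp [prodRaw]

theorem prodRaw_replicate (m : ℕ) (L : List RawApplied) (τ : ℕ → Bool) :
    prodRaw (List.replicate m L).flatten τ = prodRaw L τ ^ m := by
  induction m with
  | zero => simp [prodRaw]
  | succ m ih => rw [List.replicate_succ, List.flatten_cons, prodRaw_append, ih, pow_succ']

theorem prodRaw_congr {L : List RawApplied} {c : ℕ} (hL : ∀ a ∈ L, ∀ k, a.scope k < c)
    {τ τ' : ℕ → Bool} (h : ∀ k < c, τ' k = τ k) : prodRaw L τ' = prodRaw L τ := by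
  unfold prodRaw
  congr 1
  refine List.map_congr_left fun a ha => ?_
  unfold rawEval
  congr 1
  funext k
  exact h _ (hL a ha k)

theorem prodRaw_localize (G : List (Applied 5)) (i j c : ℕ) (τ : ℕ → Bool) :
    prodRaw (G.map (localize i j c)) τ =
      prodEval G ![τ i, τ j, τ c, τ (c + 1), τ (c + 1 + 1)] := by
  have h : ∀ v : Fin 5, τ (![i, j, c, c + 1, c + 1 + 1] v) =
      ![τ i, τ j, τ c, τ (c + 1), τ (c + 1 + 1)] v := by
    intro v
    fin_cases v <;> rfl
  simp only [prodRaw, prodEval, List.map_map]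
  congr 1
  refine List.map_congr_left fun a _ => ?_
  simp only [Function.comp_apply, rawEval, localize, Applied.eval, h]

/-- The assignment `τ` violates `a`, which is a constraint `Implies`. -/
def Violates (τ : ℕ → Bool) (a : RawApplied) : Prop :=
  a.con = implies ∧ τ (index a 0) = true ∧ τ (index a 1) = false

open scoped Classical in
theorem rawEval_of_implies {a : RawApplied} (h : a.con = implies) (τ : ℕ → Bool) :
    rawEval τ a = if Violates τ a then 0 else 1 := by
  unfold Violates
  simp only [h, true_and]
  obtain ⟨con, s⟩ := a
  subst h
  change Fin 2 → ℕ at s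
  change (if τ (s 0) = true ∧ τ (s 1) = false then (0 : ℝ≥0) else 1) =
    if τ ((List.ofFn s).getD 0 0) = true ∧ τ ((List.ofFn s).getD 1 0) = false then 0 else 1
  simp [List.ofFn_succ]

theorem index_lt_of_implies {a : RawApplied} (h : a.con = implies) {c : ℕ}
    (hc : ∀ k, a.scope k < c) : index a 0 < c ∧ index a 1 < c := by
  obtain ⟨con, s⟩ := a
  subst h
  change Fin 2 → ℕ at s
  have h0 : index ⟨implies, s⟩ 0 = s 0 := by
    change (List.ofFn s).getD 0 0 = s 0
    simp [List.ofFn_succ]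
  have h1 : index ⟨implies, s⟩ 1 = s 1 := by
    change (List.ofFn s).getD 1 0 = s 1
    simp [List.ofFn_succ]
  rw [h0, h1]
  exact ⟨hc (0 : Fin 2), hc (1 : Fin 2)⟩

open scoped Classical in
/-- The value of `a`, where `Implies` is relaxed to `(1, 1, 2 ^ (-m), 1)`. -/
noncomputable def relaxed (m : ℕ) (τ : ℕ → Bool) (a : RawApplied) : ℝ≥0 :=
  if Violates τ a then (1 / 2) ^ m else rawEval τ a

/-! ### The transformed list: upper bound, well-formedness, lifting of assignments -/

variable {f : Constraint} {G : List (Applied 5)}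

/-- Whatever the fresh variables are, each copy of the gadget is at most 1/2 when the implication is
violated and at most 1 otherwise. -/
theorem prodRaw_replacement_le (hG : IsGadget f G) (m c : ℕ) (a : RawApplied) (τ : ℕ → Bool) :
    prodRaw (replacement G m a c) τ ≤ relaxed m τ a := by
  classical
  unfold replacement relaxed
  by_cases h : a.con = implies
  · rw [if_pos h, prodRaw_replicate, prodRaw_localize, rawEval_of_implies h]
    split_ifs with hv
    · exact pow_le_pow_left₀ zero_le (hG.le_half _ hv.2.1 hv.2.2) m
    · exact pow_le_one₀ zero_le (hG.le_one _)
  · rw [if_neg h, if_neg fun hv => h hv.1]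
    simp [prodRaw]

theorem prodRaw_transform_le (hG : IsGadget f G) (m : ℕ) (L : List RawApplied) (c : ℕ)
    (acc : List RawApplied) (τ : ℕ → Bool) :
    prodRaw (transform G m L c acc).2 τ ≤ (L.map (relaxed m τ)).prod * prodRaw acc τ := by
  induction L generalizing c acc with
  | nil => simp [transform]
  | cons a L ih =>
    refine (ih _ _).trans ?_
    rw [prodRaw_append, List.map_cons, List.prod_cons]
    calc (L.map (relaxed m τ)).prod * (prodRaw (replacement G m a c) τ * prodRaw acc τ)
        ≤ (L.map (relaxed m τ)).prod * (relaxed m τ a * prodRaw acc τ) := by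
          gcongr
          exact prodRaw_replacement_le hG m c a τ
      _ = _ := by ring

theorem scope_replacement {m c : ℕ} {a : RawApplied} (ha : ∀ k, a.scope k < c) {b : RawApplied}
    (hb : b ∈ replacement G m a c) : ∀ k, b.scope k < c + fresh a := by
  classical
  unfold replacement at hb
  by_cases h : a.con = implies
  · rw [if_pos h] at hb
    obtain ⟨l, hl, hbl⟩ := List.mem_flatten.1 hb
    rw [(List.mem_replicate.1 hl).2] at hbl
    obtain ⟨g, -, rfl⟩ := List.mem_map.1 hbl
    intro k
    obtain ⟨h0, h1⟩ := index_lt_of_implies h ha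
    have hf : fresh a = 3 := by simp [fresh, h]
    simp only [localize, hf]
    generalize g.scope k = v
    fin_cases v <;> simp <;> omega
  · rw [if_neg h, List.mem_singleton] at hb
    subst hb
    exact fun k => (ha k).trans_le (Nat.le_add_right _ _)

theorem con_replacement (hG : IsGadget f G) {F : Set Constraint} {m c : ℕ} {a : RawApplied}
    (ha : a.con ∈ {implies} ∪ F ∪ unary) {b : RawApplied} (hb : b ∈ replacement G m a c) :
    b.con ∈ {f} ∪ F ∪ unary := by
  classical
  unfold replacement at hb
  by_cases h : a.con = implies
  · rw [if_pos h] at hb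
    obtain ⟨l, hl, hbl⟩ := List.mem_flatten.1 hb
    rw [(List.mem_replicate.1 hl).2] at hbl
    obtain ⟨g, hg, rfl⟩ := List.mem_map.1 hbl
    exact (hG.mem g hg).elim (fun h => Or.inl (Or.inl h)) Or.inr
  · rw [if_neg h, List.mem_singleton] at hb
    subst hb
    exact ha.elim (fun h' => h'.elim (fun h' => absurd h' h) (fun h' => Or.inl (Or.inr h'))) Or.inr

theorem transform_fst (m : ℕ) (L : List RawApplied) (c : ℕ) (acc : List RawApplied) :
    c ≤ (transform G m L c acc).1 ∧ (transform G m L c acc).1 ≤ c + 3 * L.length := by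
  classical
  induction L generalizing c acc with
  | nil => simp [transform]
  | cons a L ih =>
    have := ih (c + fresh a) (replacement G m a c ++ acc)
    have hf : fresh a ≤ 3 := by unfold fresh; split_ifs <;> omega
    simp only [transform, List.length_cons]
    omega

theorem transform_spec (hG : IsGadget f G) {F : Set Constraint} (m : ℕ) (L : List RawApplied)
    (c : ℕ) (acc : List RawApplied) (hL : ∀ a ∈ L, ∀ k, a.scope k < c)
    (hacc : ∀ a ∈ acc, ∀ k, a.scope k < c) (hLF : ∀ a ∈ L, a.con ∈ {implies} ∪ F ∪ unary)
    (haccF : ∀ a ∈ acc, a.con ∈ {f} ∪ F ∪ unary) :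
    ∀ b ∈ (transform G m L c acc).2,
      (∀ k, b.scope k < (transform G m L c acc).1) ∧ b.con ∈ {f} ∪ F ∪ unary := by
  induction L generalizing c acc with
  | nil => exact fun b hb => ⟨hacc b hb, haccF b hb⟩
  | cons a L ih =>
    refine ih (c + fresh a) (replacement G m a c ++ acc) ?_ ?_ ?_ ?_
    · exact fun b hb k => (hL b (List.mem_cons_of_mem _ hb) k).trans_le (Nat.le_add_right _ _)
    · intro b hb
      rcases List.mem_append.1 hb with hb | hb
      · exact scope_replacement (hL a List.mem_cons_self) hb
      · exact fun k => (hacc b hb k).trans_le (Nat.le_add_right _ _)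
    · exact fun b hb => hLF b (List.mem_cons_of_mem _ hb)
    · intro b hb
      rcases List.mem_append.1 hb with hb | hb
      · exact con_replacement hG (hLF a List.mem_cons_self) hb
      · exact haccF b hb

theorem exists_prodRaw_replacement (hG : IsGadget f G) (m c : ℕ) (a : RawApplied)
    (ha : ∀ k, a.scope k < c) (τ : ℕ → Bool) (hτ : ¬ Violates τ a) :
    ∃ τ' : ℕ → Bool, (∀ k < c, τ' k = τ k) ∧
      prodRaw (replacement G m a c) τ' = rawEval τ a := by
  classical
  by_cases h : a.con = implies
  · obtain ⟨h0, h1⟩ := index_lt_of_implies h ha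
    obtain ⟨z₀, z₁, z₂, hz⟩ := hG.eq_one (τ (index a 0)) (τ (index a 1)) (by
      intro h0
      by_contra h1
      exact hτ ⟨h, h0, by simpa using h1⟩)
    refine ⟨fun k => if k = c then z₀ else if k = c + 1 then z₁ else if k = c + 1 + 1 then z₂
      else τ k, fun k hk => ?_, ?_⟩
    · simp only
      rw [if_neg (by omega), if_neg (by omega), if_neg (by omega)]
    · rw [replacement, if_pos h, prodRaw_replicate, prodRaw_localize, rawEval_of_implies h,
        if_neg hτ]
      simp only [if_true]
      rw [if_neg (show index a 0 ≠ c by omega), if_neg (show index a 0 ≠ c + 1 by omega),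
        if_neg (show index a 0 ≠ c + 1 + 1 by omega), if_neg (show index a 1 ≠ c by omega),
        if_neg (show index a 1 ≠ c + 1 by omega), if_neg (show index a 1 ≠ c + 1 + 1 by omega),
        if_neg (show c + 1 ≠ c by omega), if_neg (show c + 1 + 1 ≠ c by omega),
        if_neg (show c + 1 + 1 ≠ c + 1 by omega), hz, one_pow]
  · refine ⟨τ, fun _ _ => rfl, ?_⟩
    rw [replacement, if_neg h]
    simp [prodRaw]

/-- The gadgets have private fresh variables, so their witnesses can be chosen one constraint at a
time: a later choice changes only indices from the counter `c` on, which earlier constraints do not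
use. -/
theorem exists_prodRaw_transform (hG : IsGadget f G) (m : ℕ) (L : List RawApplied) (c : ℕ)
    (acc : List RawApplied) (hL : ∀ a ∈ L, ∀ k, a.scope k < c)
    (hacc : ∀ a ∈ acc, ∀ k, a.scope k < c) (τ : ℕ → Bool) (hτ : ∀ a ∈ L, ¬ Violates τ a) :
    ∃ τ' : ℕ → Bool, (∀ k < c, τ' k = τ k) ∧
      prodRaw (transform G m L c acc).2 τ' = prodRaw L τ * prodRaw acc τ := by
  induction L generalizing c acc τ with
  | nil => exact ⟨τ, fun _ _ => rfl, by simp [transform, prodRaw]⟩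
  | cons a L ih =>
    have ha := hL a List.mem_cons_self
    have hL' : ∀ b ∈ L, ∀ k, b.scope k < c := fun b hb => hL b (List.mem_cons_of_mem _ hb)
    obtain ⟨τ₁, h1, h2⟩ := exists_prodRaw_replacement hG m c a ha τ (hτ a List.mem_cons_self)
    have hviol : ∀ b ∈ L, ¬ Violates τ₁ b := by
      rintro b hb ⟨hbi, h0, h1'⟩
      obtain ⟨i0, i1⟩ := index_lt_of_implies hbi (hL' b hb)
      rw [h1 _ i0] at h0
      rw [h1 _ i1] at h1'
      exact hτ b (List.mem_cons_of_mem _ hb) ⟨hbi, h0, h1'⟩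
    obtain ⟨τ₂, h3, h4⟩ := ih (c + fresh a) (replacement G m a c ++ acc)
      (fun b hb k => (hL' b hb k).trans_le (Nat.le_add_right _ _))
      (fun b hb => (List.mem_append.1 hb).elim (fun hb => scope_replacement ha hb)
        (fun hb k => (hacc b hb k).trans_le (Nat.le_add_right _ _))) τ₁ hviol
    refine ⟨τ₂, fun k hk => (h3 k (by omega)).trans (h1 k hk), ?_⟩
    rw [transform, h4, prodRaw_append, h2, prodRaw_cons, prodRaw_congr hL' h1,
      prodRaw_congr hacc h1]
    ring

end Reduction

namespace Reduction

open Constraint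

/-! ### Bounds for the values of an instance -/

/-- The bound that is computed by `scan`. -/
noncomputable def bound (w : List ℝ) : ℝ := (w.map (scale 1)).prod

theorem foldl_scale (w : List ℝ) (b : ℝ) : w.foldl scale b = b * bound w := by
  have h : ∀ b r, scale b r = b * scale 1 r := by
    intro b r
    unfold scale
    split_ifs <;> ring
  induction w generalizing b with
  | nil => simp [bound]
  | cons r w ih =>
    rw [List.foldl_cons, ih, h, bound, bound, List.map_cons, List.prod_cons, mul_assoc]

theorem one_le_scale (r : ℝ) : 1 ≤ scale 1 r := by
  unfold scale
  split_ifs with h0 h1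
  · exact le_rfl
  · exact (one_le_div (not_le.1 h0)).2 h1
  · linarith

theorem le_scale {r : ℝ} : r ≤ scale 1 r := by
  unfold scale
  split_ifs with h0 h1
  · linarith
  · exact h1.trans ((one_le_div (not_le.1 h0)).2 h1)
  · linarith

theorem one_le_mul_scale {r : ℝ} (hr : 0 < r) : 1 ≤ r * scale 1 r := by
  unfold scale
  split_ifs with h0 h1
  · linarith
  · rw [mul_one_div, div_self hr.ne']
  · nlinarith

theorem bound_append (w w' : List ℝ) : bound (w ++ w') = bound w * bound w' := by
  simp [bound]

theorem one_le_bound (w : List ℝ) : 1 ≤ bound w := by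
  induction w with
  | nil => simp [bound]
  | cons r w ih =>
    rw [bound, List.map_cons, List.prod_cons]
    exact one_le_mul_of_one_le_of_one_le (one_le_scale r) ih

theorem scale_le_bound {r : ℝ} {w : List ℝ} (h : r ∈ w) : scale 1 r ≤ bound w := by
  obtain ⟨w₁, w₂, rfl⟩ := List.append_of_mem h
  have h1 := one_le_bound w₁
  have h2 := one_le_bound w₂
  have h3 := one_le_scale r
  have h4 : bound (r :: w₂) = scale 1 r * bound w₂ := by simp [bound]
  rw [bound_append, h4]
  calc scale 1 r ≤ scale 1 r * bound w₂ := le_mul_of_one_le_right (by linarith) h2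
    _ ≤ bound w₁ * (scale 1 r * bound w₂) := le_mul_of_one_le_left (by positivity) h1

/-- This is where the size measure enters: the term |log₂|r|| pays for max(r, 1/r), so the threshold
is at most exponential in the size and m is linear in it. -/
theorem scale_le_rpow (r : ℝ) : scale 1 r ≤ 2 ^ (1 + |Real.logb 2 (|r|)|) := by
  have h1 : (1 : ℝ) ≤ 2 ^ (1 + |Real.logb 2 (|r|)|) :=
    Real.one_le_rpow one_le_two (by positivity)
  unfold scale
  split_ifs with h0 hr1
  · exact h1
  · have hr : 0 < r := not_le.1 h0
    rw [abs_of_pos hr, one_div]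
    calc r⁻¹ = 2 ^ (-Real.logb 2 r) := by
          rw [Real.rpow_neg two_pos.le, Real.rpow_logb two_pos (by norm_num) hr]
      _ ≤ _ := Real.rpow_le_rpow_of_exponent_le one_le_two
          ((neg_le_abs _).trans (by linarith))
  · have hr : 0 < r := not_le.1 h0
    rw [abs_of_pos hr, one_mul]
    calc r = 2 ^ (Real.logb 2 r) := (Real.rpow_logb two_pos (by norm_num) hr).symm
      _ ≤ _ := Real.rpow_le_rpow_of_exponent_le one_le_two
          ((le_abs_self _).trans (by linarith))

theorem bound_le_rpow (w : List ℝ) : bound w ≤ 2 ^ wordSize w := by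
  induction w with
  | nil => simp [bound, wordSize]
  | cons r w ih =>
    have h1 : bound (r :: w) = scale 1 r * bound w := by simp [bound]
    have h2 : wordSize (r :: w) = (1 + |Real.logb 2 (|r|)|) + wordSize w := by simp [wordSize]
    rw [h1, h2, Real.rpow_add two_pos]
    exact mul_le_mul (scale_le_rpow r) ih (by linarith [one_le_bound w]) (by positivity)

theorem length_le_wordSize (w : List ℝ) : (w.length : ℝ) ≤ wordSize w := by
  induction w with
  | nil => simp [wordSize]
  | cons r w ih =>
    have h2 : wordSize (r :: w) = (1 + |Real.logb 2 (|r|)|) + wordSize w := by simp [wordSize]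
    rw [h2, List.length_cons, Nat.cast_add, Nat.cast_one]
    linarith [abs_nonneg (Real.logb 2 (|r|))]

theorem length_le_encList (l : List (List ℝ)) : l.length ≤ (encList l).length := by
  induction l with
  | nil => simp
  | cons w l ih => simp only [encList, List.length_cons, List.length_append]; omega

theorem mem_table (k : ℕ) (g : (Fin k → Bool) → ℝ≥0) (x : Fin k → Bool) : g x ∈ table k g := by
  induction k with
  | zero =>
    rw [table, List.mem_singleton]
    congr 1
    funext i
    exact i.elim0
  | succ k ih =>
    rw [table, List.mem_append]
    have hx : x = Fin.cons (x 0) (Fin.tail x) := (Fin.cons_self_tail x).symm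
    cases h : x 0 with
    | false =>
      left
      rw [h] at hx
      have := ih (fun x => g (Fin.cons false x)) (Fin.tail x)
      rwa [← hx] at this
    | true =>
      right
      rw [h] at hx
      have := ih (fun x => g (Fin.cons true x)) (Fin.tail x)
      rwa [← hx] at this

/-- Every value a constraint can take is an entry of the instance word, so a product over all
entries controls all measures. -/
theorem rawEval_mem_enc (τ : ℕ → Bool) (a : RawApplied) : (rawEval τ a : ℝ) ∈ a.enc := by
  have h : (rawEval τ a : ℝ) ∈ a.values :=
    List.mem_map_of_mem (f := fun r : ℝ≥0 => (r : ℝ)) (mem_table _ _ _)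
  rw [RawApplied.enc, List.mem_append, tagged_eq a.values]
  exact Or.inr (List.mem_append_left _ (List.mem_flatMap.2 ⟨_, h, by simp⟩))

/-- The product of the bounds of the single constraints. -/
noncomputable def listBound (L : List RawApplied) : ℝ := (L.map (fun a => bound a.enc)).prod

theorem listBound_cons (a : RawApplied) (L : List RawApplied) :
    listBound (a :: L) = bound a.enc * listBound L := by simp [listBound]

theorem one_le_listBound (L : List RawApplied) : 1 ≤ listBound L := by
  induction L with
  | nil => simp [listBound]
  | cons a L ih =>
    rw [listBound_cons]
    exact one_le_mul_of_one_le_of_one_le (one_le_bound _) ih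

theorem listBound_le (L : List RawApplied) : listBound L ≤ bound (encList (L.map RawApplied.enc)) := by
  induction L with
  | nil => simpa [listBound] using one_le_bound _
  | cons a L ih =>
    have h : bound (encList ((a :: L).map RawApplied.enc)) =
        scale 1 1 * (bound a.enc * bound (encList (L.map RawApplied.enc))) := by
      simp [bound, encList]
    have h1 : scale 1 1 = 1 := by norm_num [scale]
    rw [h, h1, one_mul, listBound_cons]
    exact mul_le_mul_of_nonneg_left ih (by linarith [one_le_bound a.enc])

theorem relaxed_le (m : ℕ) (τ : ℕ → Bool) (a : RawApplied) :
    (relaxed m τ a : ℝ) ≤ bound a.enc := by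
  classical
  unfold relaxed
  split_ifs
  · push_cast
    exact (pow_le_one₀ (by norm_num) (by norm_num)).trans (one_le_bound _)
  · exact le_scale.trans (scale_le_bound (rawEval_mem_enc τ a))

theorem prod_relaxed_le (m : ℕ) (τ : ℕ → Bool) (L : List RawApplied) :
    ((L.map (relaxed m τ)).prod : ℝ) ≤ listBound L := by
  induction L with
  | nil => simp [listBound]
  | cons a L ih =>
    rw [List.map_cons, List.prod_cons, NNReal.coe_mul, listBound_cons]
    exact mul_le_mul (relaxed_le m τ a) ih (NNReal.coe_nonneg _) (by linarith [one_le_bound a.enc])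

/-- One violated constraint contributes exactly 2^(-m); its own bound, being at least 1, is put in
for free. -/
theorem prod_relaxed_le_of_violates (m : ℕ) (τ : ℕ → Bool) (L : List RawApplied)
    (h : ∃ a ∈ L, Violates τ a) :
    ((L.map (relaxed m τ)).prod : ℝ) ≤ (1 / 2) ^ m * listBound L := by
  classical
  induction L with
  | nil => simp at h
  | cons a L ih =>
    rw [List.map_cons, List.prod_cons, NNReal.coe_mul, listBound_cons]
    have ha := one_le_bound a.enc
    have hLb := one_le_listBound L
    by_cases hv : Violates τ a
    · have h1 : (relaxed m τ a : ℝ) = (1 / 2) ^ m := by simp [relaxed, hv]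
      rw [h1]
      refine mul_le_mul_of_nonneg_left ?_ (by positivity)
      exact (prod_relaxed_le m τ L).trans (le_mul_of_one_le_left (by linarith) ha)
    · have h' : ∃ b ∈ L, Violates τ b := by
        obtain ⟨b, hb, hbv⟩ := h
        rcases List.mem_cons.1 hb with rfl | hb
        · exact absurd hbv hv
        · exact ⟨b, hb, hbv⟩
      calc _ ≤ bound a.enc * ((1 / 2) ^ m * listBound L) :=
            mul_le_mul (relaxed_le m τ a) (ih h') (NNReal.coe_nonneg _) (by linarith)
        _ = _ := by ring

theorem prod_relaxed_eq (m : ℕ) (τ : ℕ → Bool) (L : List RawApplied)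
    (h : ∀ a ∈ L, ¬ Violates τ a) : (L.map (relaxed m τ)).prod = prodRaw L τ := by
  classical
  unfold prodRaw
  congr 1
  exact List.map_congr_left fun a ha => by rw [relaxed, if_neg (h a ha)]

/-- Each factor is nonzero, hence at least the inverse of its bound; this bounds nonzero measures
from below. -/
theorem one_le_prodRaw_mul (τ : ℕ → Bool) (L : List RawApplied) (h : prodRaw L τ ≠ 0) :
    1 ≤ (prodRaw L τ : ℝ) * listBound L := by
  induction L with
  | nil => simp [prodRaw, listBound]
  | cons a L ih =>
    rw [prodRaw_cons] at h ⊢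
    have ha : rawEval τ a ≠ 0 := left_ne_zero_of_mul h
    have hpos : (0 : ℝ) < rawEval τ a := NNReal.coe_pos.2 (pos_iff_ne_zero.2 ha)
    have h1 : 1 ≤ (rawEval τ a : ℝ) * bound a.enc :=
      (one_le_mul_scale hpos).trans
        (mul_le_mul_of_nonneg_left (scale_le_bound (rawEval_mem_enc τ a)) hpos.le)
    have h2 := ih (right_ne_zero_of_mul h)
    rw [listBound_cons, NNReal.coe_mul]
    calc (1 : ℝ) ≤ ((rawEval τ a : ℝ) * bound a.enc) * ((prodRaw L τ : ℝ) * listBound L) :=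
          one_le_mul_of_one_le_of_one_le h1 h2
      _ = _ := by ring

theorem not_violates_of_prodRaw_ne_zero {τ : ℕ → Bool} {L : List RawApplied}
    (h : prodRaw L τ ≠ 0) : ∀ a ∈ L, ¬ Violates τ a := by
  classical
  intro a ha hv
  refine h (List.prod_eq_zero (List.mem_map.2 ⟨a, ha, ?_⟩))
  rw [rawEval_of_implies hv.1, if_pos hv]

/-! ### The instance that is passed to the oracle -/

/-- Forgetting `n` keeps the type of the constraints fixed while variables are being added. -/
def toRaw {n : ℕ} (a : Applied n) : RawApplied := ⟨a.con, fun k => a.scope k⟩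

theorem enc_toRaw {n : ℕ} (a : Applied n) : (toRaw a).enc = a.enc := by
  rw [RawApplied.enc_eq]
  rfl

theorem prodEval_eq_prodRaw {n : ℕ} (H : List (Applied n)) (σ : Fin n → Bool) (τ : ℕ → Bool)
    (h : ∀ i : Fin n, τ i = σ i) : prodEval H σ = prodRaw (H.map toRaw) τ := by
  simp only [prodEval, prodRaw, List.map_map]
  congr 1
  refine List.map_congr_left fun a _ => ?_
  simp only [Applied.eval, Function.comp_apply, rawEval, toRaw, h]

variable {f : Constraint} {G : List (Applied 5)} {F : Set Constraint}

/-- The list of constraints of an instance. -/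
def rawCons (x : CSPInstance ({implies} ∪ F ∪ unary)) : List RawApplied := x.cons.map toRaw

theorem scope_rawCons (x : CSPInstance ({implies} ∪ F ∪ unary)) :
    ∀ a ∈ rawCons x, ∀ k, a.scope k < x.n := by
  intro a ha
  obtain ⟨b, -, rfl⟩ := List.mem_map.1 ha
  exact fun k => (b.scope k).2

theorem target_spec (hG : IsGadget f G) (m : ℕ) (x : CSPInstance ({implies} ∪ F ∪ unary)) :
    ∀ b ∈ (transform G m (rawCons x) x.n []).2,
      (∀ k, b.scope k < (transform G m (rawCons x) x.n []).1) ∧ b.con ∈ {f} ∪ F ∪ unary := by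
  refine transform_spec hG m (rawCons x) x.n [] (scope_rawCons x) (by simp) ?_ (by simp)
  intro a ha
  obtain ⟨b, hb, rfl⟩ := List.mem_map.1 ha
  exact x.mem b hb

/-- The instance that is passed to the oracle. -/
noncomputable def target (hG : IsGadget f G) (m : ℕ) (x : CSPInstance ({implies} ∪ F ∪ unary)) :
    CSPInstance ({f} ∪ F ∪ unary) where
  n := (transform G m (rawCons x) x.n []).1
  cons := (transform G m (rawCons x) x.n []).2.pmap
    (fun b hb => (⟨b.con, fun k => ⟨b.scope k, hb k⟩⟩ : Applied _))
    (fun b hb => (target_spec hG m x b hb).1)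
  mem := by
    intro a ha
    obtain ⟨b, hb, rfl⟩ := List.mem_pmap.1 ha
    exact (target_spec hG m x b hb).2

theorem map_toRaw_target (hG : IsGadget f G) (m : ℕ) (x : CSPInstance ({implies} ∪ F ∪ unary)) :
    (target hG m x).cons.map toRaw = (transform G m (rawCons x) x.n []).2 := by
  rw [target, List.map_pmap]
  exact (List.pmap_eq_map (p := fun _ => _) (f := id) _).trans (List.map_id _)

theorem enc_eq {F' : Set Constraint} (x : CSPInstance F') :
    x.enc = encList (List.replicate x.n []) ++
      encList ((x.cons.map toRaw).map RawApplied.enc) := by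
  rw [CSPInstance.enc, List.map_map]
  congr 3
  funext a
  exact (enc_toRaw a).symm

theorem le_target_n (hG : IsGadget f G) (m : ℕ) (x : CSPInstance ({implies} ∪ F ∪ unary)) :
    x.n ≤ (target hG m x).n := (transform_fst m (rawCons x) x.n []).1

/-- Approximate solutions of the new instance yield approximate solutions of the old one. -/
theorem isApproxSol_restrict (hG : IsGadget f G) {m : ℕ}
    (x : CSPInstance ({implies} ∪ F ∪ unary))
    (hm : bound x.enc * bound x.enc + bound x.enc * bound x.enc < 2 ^ m) {ε : ℝ} (hε : 0 < ε)
    (hε1 : ε < 1) (σ : Fin (target hG m x).n → Bool)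
    (h : (MaxProdCSPStar ({f} ∪ F)).IsApproxSol (target hG m x) (2 ^ ε) σ) :
    (MaxProdCSPStar ({implies} ∪ F)).IsApproxSol x (2 ^ ε)
      (fun i => σ (Fin.castLE (le_target_n hG m x) i)) := by
  classical
  set L := rawCons x with hL
  set B := bound x.enc with hB
  have hB1 : 1 ≤ B := one_le_bound _
  have hLB : listBound L ≤ B := by
    rw [hB, enc_eq, bound_append]
    exact (listBound_le L).trans (le_mul_of_one_le_left
      (by linarith [one_le_bound (encList (L.map RawApplied.enc))])
      (one_le_bound _))
  -- assignments of all variables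
  set τ : ℕ → Bool := fun k => if hk : k < (target hG m x).n then σ ⟨k, hk⟩ else false with hτ
  have hmeas : ∀ (ρ : Fin x.n → Bool) (τ : ℕ → Bool), (∀ i : Fin x.n, τ i = ρ i) →
      (MaxProdCSPStar ({implies} ∪ F)).measure x ρ = prodRaw L τ :=
    fun ρ τ h => prodEval_eq_prodRaw x.cons ρ τ h
  have hmeas' : ∀ (ρ : Fin (target hG m x).n → Bool) (τ : ℕ → Bool),
      (∀ i : Fin (target hG m x).n, τ i = ρ i) →
      (MaxProdCSPStar ({f} ∪ F)).measure (target hG m x) ρ =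
        prodRaw (transform G m L x.n []).2 τ := by
    intro ρ τ h
    rw [← map_toRaw_target hG]
    exact prodEval_eq_prodRaw _ ρ τ h
  have hσ' := hmeas' σ τ (fun i => by simp [hτ])
  have hσ := hmeas (fun i => σ (Fin.castLE (le_target_n hG m x) i)) τ
    (fun i => by
      have : (i : ℕ) < (target hG m x).n := i.2.trans_le (le_target_n hG m x)
      simp only [hτ, this, dif_pos]
      rfl)
  obtain ⟨ρ, hρ⟩ := Finite.exists_max
    (fun ρ : Fin x.n → Bool => (MaxProdCSPStar ({implies} ∪ F)).measure x ρ)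
  refine ⟨(MaxProdCSPStar ({implies} ∪ F)).measure x ρ, ⟨⟨ρ, rfl⟩, ?_⟩, ?_, ?_⟩
  · rintro _ ⟨ρ', rfl⟩
    exact hρ ρ'
  · intro h0
    exact le_antisymm ((hρ _).trans h0.le) zero_le
  intro hne
  set opt := (MaxProdCSPStar ({implies} ∪ F)).measure x ρ with hopt
  set τ₀ : ℕ → Bool := fun k => if hk : k < x.n then ρ ⟨k, hk⟩ else false with hτ₀
  have hρL : opt = prodRaw L τ₀ := hmeas ρ τ₀ (fun i => by simp [hτ₀])
  -- An optimal assignment of nonzero measure violates no Implies, so it lifts with its value, and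
  -- opt ≤ opt'.
  obtain ⟨τ₁, -, hτ₁⟩ := exists_prodRaw_transform hG m L x.n [] (scope_rawCons x) (by simp) τ₀
    (not_violates_of_prodRaw_ne_zero (hρL ▸ hne))
  obtain ⟨opt', ⟨-, hmax⟩, -, hopt'⟩ := h
  have hle : opt ≤ opt' := by
    have h1 := hmax ⟨fun i => τ₁ i, rfl⟩
    rw [hmeas' (fun i => τ₁ i) τ₁ (fun _ => rfl), hτ₁, ← hρL] at h1
    simpa [prodRaw] using h1
  have hoptpos : 0 < opt := pos_iff_ne_zero.2 hne
  have hopt'pos : 0 < opt' := hoptpos.trans_le hle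
  have happrox := (hopt' hopt'pos.ne').1
  rw [hσ'] at happrox
  have h2ε : (1 : ℝ) < 2 ^ ε := Real.one_lt_rpow one_lt_two hε
  have h2ε' : (2 : ℝ) ^ ε ≤ 2 := by
    calc (2 : ℝ) ^ ε ≤ 2 ^ (1 : ℝ) := Real.rpow_le_rpow_of_exponent_le one_le_two hε1.le
      _ = 2 := Real.rpow_one 2
  have hoptR : (0 : ℝ) < opt := NNReal.coe_pos.2 hoptpos
  have hopt'R : (0 : ℝ) < opt' := NNReal.coe_pos.2 hopt'pos
  have hleR : (opt : ℝ) ≤ opt' := NNReal.coe_le_coe.2 hle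
  have hlow : (opt : ℝ) / 2 ^ ε ≤ prodRaw (transform G m L x.n []).2 τ := by
    rw [le_div_iff₀ hopt'R, one_div, inv_mul_eq_div] at happrox
    exact (div_le_div_of_nonneg_right hleR (by positivity)).trans happrox
  have hupp : (prodRaw (transform G m L x.n []).2 τ : ℝ) ≤ (L.map (relaxed m τ)).prod := by
    have := prodRaw_transform_le hG m L x.n [] τ
    exact NNReal.coe_le_coe.2 (by simpa [prodRaw] using this)
  -- A violation would give 1/(2B) ≤ opt/2 ≤ opt/2^ε ≤ 2^(-m) B, hence 2^m ≤ 2B², against `hm`.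
  have hviol : ∀ a ∈ L, ¬ Violates τ a := by
    by_contra hcon
    push Not at hcon
    have h1 := prod_relaxed_le_of_violates m τ L hcon
    have h2 : 1 ≤ (opt : ℝ) * listBound L := by
      rw [hρL]
      exact one_le_prodRaw_mul τ₀ L (hρL ▸ hne)
    have h3 : 1 ≤ (opt : ℝ) * B := h2.trans (mul_le_mul_of_nonneg_left hLB hoptR.le)
    have h4 : (opt : ℝ) / 2 ≤ opt / 2 ^ ε :=
      div_le_div_of_nonneg_left hoptR.le (by positivity) h2ε'
    have h5 : (opt : ℝ) / 2 ≤ (1 / 2) ^ m * B :=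
      (h4.trans (hlow.trans (hupp.trans h1))).trans (mul_le_mul_of_nonneg_left hLB (by positivity))
    have h6 : (1 / 2 : ℝ) ^ m * 2 ^ m = 1 := by rw [← mul_pow]; norm_num
    have h7 : (0 : ℝ) < 2 ^ m := by positivity
    have h8 : (1 : ℝ) ≤ 2 * B * ((1 / 2) ^ m * B) := by nlinarith
    have h9 : (2 : ℝ) ^ m ≤ 2 * B * B := by
      calc (2 : ℝ) ^ m = 2 ^ m * 1 := (mul_one _).symm
        _ ≤ 2 ^ m * (2 * B * ((1 / 2) ^ m * B)) := mul_le_mul_of_nonneg_left h8 h7.le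
        _ = 2 * B * B * ((1 / 2) ^ m * 2 ^ m) := by ring
        _ = 2 * B * B := by rw [h6, mul_one]
    linarith
  -- Without violations the relaxed product is the measure of the restricted assignment.
  rw [prod_relaxed_eq m τ L hviol, ← hσ] at hupp
  have hfin := hlow.trans hupp
  constructor
  · rw [le_div_iff₀ hoptR, one_div, inv_mul_eq_div]
    exact hfin
  · rw [div_le_iff₀ hoptR]
    have h1 := NNReal.coe_le_coe.2 (hρ (fun i => σ (Fin.castLE (le_target_n hG m x) i)))
    nlinarith

/-! ### The reduction -/

theorem aptReduces_of_isGadget (hG : IsGadget f G) (F : Set Constraint) :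
    APTReduces (MaxProdCSPStar ({implies} ∪ F)) (MaxProdCSPStar ({f} ∪ F)) := by
  set K : ℕ := 2 * (symbolsList G).length + 10 with hK
  -- The call uses δ = ε, whence the polynomial X 1. In the time bound, 98 = 50 + 20 + 4 + 12 + 12
  -- collects the linear terms (the summand 4n' is at most 4n + 12 times the number of constraints),
  -- and 106 = 100 + 3 + 3.
  refine ⟨program G, MvPolynomial.X 1,
    98 * MvPolynomial.X 0 + MvPolynomial.X 0 * ((2 * MvPolynomial.X 0 + 2) *
      MvPolynomial.C (K : ℝ) + 201) + 106, fun M hM x ε hε hε1 => ?_⟩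
  change CSPInstance ({implies} ∪ F ∪ unary) at x
  set W := x.enc with hW
  set B := bound W with hB
  have hB1 : 1 ≤ B := one_le_bound W
  obtain ⟨m', hm'low, hm'high⟩ := exists_nat_pow_near (x := B * B + B * B) (y := (2 : ℝ))
    (by nlinarith) one_lt_two
  set m := m' + 1 with hm
  have hlow : ∀ k < m, (2 : ℝ) ^ k ≤ B * B + B * B := fun k hk =>
    (pow_le_pow_right₀ one_le_two (by omega)).trans hm'low
  have hWeq : W = encList (List.replicate x.n []) ++ encList ((rawCons x).map RawApplied.enc) :=
    enc_eq x
  have hveq : (target hG m x).enc =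
      encList (List.replicate (transform G m (rawCons x) x.n []).1 []) ++
        encList ((transform G m (rawCons x) x.n []).2.map RawApplied.enc) := by
    rw [enc_eq, map_toRaw_target]
    rfl
  have hquery := runs_query G m x.n ε B (rawCons x)
    (by rw [foldl_scale, one_mul, ← hWeq]) hlow hm'high
  rw [← hWeq, ← hveq] at hquery
  set T₁ := 50 * W.length + (rawCons x).length * (m * K + 201) + 20 * x.n +
    4 * (transform G m (rawCons x) x.n []).1 + 100 with hT₁
  have hstart : Config.start (program G) (ε :: W) =
      ⟨[.seq (query G) (.seq (.call 9 3) answer)],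
        mem [ε :: W, [], [], [], [], [], [], [], [], [], [], [], [], [], [], []]⟩ := by
    have h0 : (fun _ => []) =
        mem [[], [], [], [], [], [], [], [], [], [], [], [], [], [], [], []] := by
      funext s
      by_cases hs : s < 16
      · interval_cases s <;> rfl
      · exact (List.getD_eq_default _ _ (by simpa using hs)).symm
    rw [Config.start, h0, update_mem (by simp)]
    rfl
  have hanswer : ∀ w : List ℝ, Runs answer (Function.update (Function.update
      (mem [[0], [], [ε], [], [B * B + B * B], [1], [], [], List.replicate x.n 1,
        ε :: (target hG m x).enc, [], [], [((transform G m (rawCons x) x.n []).1 : ℝ)],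
        [], [], []]) 9 []) 3 w)
      (mem [[0], List.ofFn (fun i : Fin x.n => w.getD i 0), [ε], w.drop x.n, [B * B + B * B], [1],
        [], [], [], [], [], [], [((transform G m (rawCons x) x.n []).1 : ℝ)], [], [], []])
      (12 * x.n + 3) := by
    intro w
    rw [update_mem (by simp), update_mem (by simp)]
    exact runs_answer x.n w _ _ _ _ _ _ _ _ _ _ _ _
  obtain ⟨hcalls, T, hT, hrun⟩ := run_single_call hquery hanswer M
  rw [← hstart] at hcalls hrun
  refine ⟨fun t C hC w hw => ⟨target hG m x, ε, hcalls t C hC w hw, hε, hε1, by simp⟩, T, ?_, ?_, ?_⟩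
  · -- the running time
    set s := (MaxProdCSPStar ({implies} ∪ F)).size x with hs
    have hlen : (W.length : ℝ) ≤ s := length_le_wordSize W
    have hn : (x.n : ℝ) ≤ s := by
      refine le_trans ?_ hlen
      rw [hWeq, List.length_append]
      have := length_le_encList (List.replicate x.n [])
      rw [List.length_replicate] at this
      exact_mod_cast this.trans (Nat.le_add_right _ _)
    have hcons : ((rawCons x).length : ℝ) ≤ s := by
      refine le_trans ?_ hlen
      rw [hWeq, List.length_append]
      have := length_le_encList ((rawCons x).map RawApplied.enc)
      rw [List.length_map] at this
      exact_mod_cast this.trans (Nat.le_add_left _ _)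
    have hn' : ((transform G m (rawCons x) x.n []).1 : ℝ) ≤ x.n + 3 * (rawCons x).length := by
      exact_mod_cast (transform_fst m (rawCons x) x.n []).2
    have hs0 : 0 ≤ s := (Nat.cast_nonneg _).trans hn
    -- From 2^(m - 1) ≤ 2B² and B ≤ 2^s it follows that m - 1 ≤ 2s + 1.
    have hmle : (m : ℝ) ≤ 2 * s + 2 := by
      have h1 : (2 : ℝ) ^ (m' : ℝ) ≤ 2 ^ (1 + (s + s)) := by
        rw [Real.rpow_natCast, Real.rpow_add two_pos, Real.rpow_add two_pos, Real.rpow_one]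
        have hBs : B ≤ 2 ^ s := bound_le_rpow W
        nlinarith
      have h2 := (Real.rpow_le_rpow_left_iff one_lt_two).1 h1
      rw [hm, Nat.cast_add, Nat.cast_one]
      linarith
    have hTR : (T : ℝ) ≤ T₁ + (12 * x.n + 3) + 3 := by exact_mod_cast hT
    have hT₁R : (T₁ : ℝ) = 50 * W.length + (rawCons x).length * (m * K + 201) + 20 * x.n +
        4 * (transform G m (rawCons x) x.n []).1 + 100 := by
      rw [hT₁]; push_cast; ring
    have hprod : ((rawCons x).length : ℝ) * (m * K + 201) ≤ s * ((2 * s + 2) * K + 201) := by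
      gcongr
    simp only [map_add, map_mul, MvPolynomial.eval_X, MvPolynomial.eval_C, map_ofNat,
      Matrix.cons_val_zero]
    linarith
  · intro C hC
    change C ∈ (Config.run M T (Config.start (program G) (ε :: W))).support at hC
    rw [hrun, PMF.mem_support_map_iff] at hC
    obtain ⟨w, -, rfl⟩ := hC
    rfl
  · change _ ≤ ((Config.run M T (Config.start (program G) (ε :: W))).map
      Config.output).toOuterMeasure _
    rw [hrun, PMF.map_comp, PMF.toOuterMeasure_map_apply]
    -- There is one call and no further randomness, so it is enough that good answers are mapped to
    -- good outputs.
    refine (hM (target hG m x) ε hε hε1).trans (MeasureTheory.measure_mono ?_)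
    rintro o ⟨σ, rfl, hσ⟩
    refine ⟨_, ?_, isApproxSol_restrict hG x hm'high hε hε1 σ hσ⟩
    change List.ofFn (fun i : Fin x.n => (List.ofFn (fun i => encBit (σ i))).getD i 0) =
      List.ofFn (fun i : Fin x.n => encBit (σ (Fin.castLE (le_target_n hG m x) i)))
    congr 1
    funext i
    -- The old variables keep their indices, so the first n entries of the answer encode the
    -- restriction.
    have hi : (i : ℕ) < (target hG m x).n := i.2.trans_le (le_target_n hG m x)
    rw [List.getD_eq_getElem _ _ (by simpa using hi), List.getElem_ofFn]
    rfl

end Reduction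

theorem mainTheorem4 (f : Constraint) (hf : f.HasImpSupport)
    (h : ¬ f.HasAffineSupport ∨ f ∉ Constraint.ED) (F : Set Constraint) :
    APTReduces (MaxProdCSPStar ({Constraint.implies} ∪ F)) (MaxProdCSPStar ({f} ∪ F)) := by
  obtain ⟨G, hG⟩ := Constraint.exists_gadget hf h
  exact Reduction.aptReduces_of_isGadget hG F
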